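/- Let $r\ge 2$ and $d\ge 1$ be integers, let $P=\mathbb{C}[X_0,\dots,X_r]$ with irrelevant ideal $\mathbf m=(X_0,\dots,X_r)$, and let $f\in P$ be a reduced (i.e. square-free) homogeneous polynomial of degree $d$. Let $X=V(f)\subset\mathbb{P}^r$, $J(f)=(\partial f/\partial X_0,\dots,\partial f/\partial X_r)$ and $R(f)=P/J(f)$. Let $H^0_{\mathbf m}(R(f))$ be the $0$-th local cohomology of $R(f)$, that is, the submodule of the elements annihilated by some power of $\mathbf m$. Let $\mathcal{J}_{f/X}\subset\mathcal{O}_X$ be the image in $\mathcal O_X$ of the ideal sheaf associated to $J(f)$. Let $T\langle X\rangle$ be the sheaf of logarithmic vector fields along $X$, i.e. the kernel of the surjection $$\eta: T_{\mathbb{P}^r}\to \mathcal{J}_{f/X}(d),\qquad \eta\Big(\sum_i A_i\frac{\partial}{\partial X_i}\Big)=\sum_i A_i\frac{\partial f}{\partial X_i},$$ where, by the Euler sequence, local vector fields on $\mathbb{P}^r$ are written as $\sum_i A_i\,\partial/\partial X_i$ with $A_i$ local sections of $\mathcal{O}(1)$, modulo multiples of $\sum_i X_i\,\partial/\partial X_i$.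 Put $$H^1_*(T\langle X\rangle(-d))=\bigoplus_{k\in\mathbb{Z}}H^1(\mathbb{P}^r,T\langle X\rangle(k-d)),$$ a graded $P$-module. Then there is a canonical isomorphism of graded $P$-modules $$H^0_{\mathbf m}(R(f))\;\cong\; H^1_*(T\langle X\rangle(-d)).$$ Explicitly, if $a\in P$ is homogeneous of degree $k$ and its class in $R(f)$ lies in $H^0_{\mathbf m}(R(f))$, then the image of $a$ in $H^0(\mathcal{O}_X(k))$ is a global section of $\mathcal{J}_{f/X}(k)$, and the isomorphism sends the class of $a$ to the image of this section under the connecting homomorphism $H^0(\mathcal{J}_{f/X}(k))\to H^1(T\langle X\rangle(k-d))$ of the exact sequence $0\to T\langle X\rangle(k-d)\to T_{\mathbb{P}^r}(k-d)\to\mathcal{J}_{f/X}(k)\to 0$. In particular, if $X$ is nonsingular (at every point of $X$ some $\partial f/\partial X_i$ is nonzero), this isomorphism is defined on all of $R(f)$: there is an isomorphism of graded $P$-modules $R(f)\cong H^1_*(T\langle X\rangle(-d))$ which restricts to the one above on $H^0_{\mathbf m}(R(f))$. -/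

import Mathlib

noncomputable section

namespace LogSheaf

open CategoryTheory TopologicalSpace Opposite MvPolynomial
open scoped DirectSum

-- this instance competes with the quiver structure underlying a category
attribute [-instance] CategoryTheory.catToReflQuiver

/-! ### Projective space and its graded coordinate ring -/

/-- The polynomial ring `ℂ[X₀, …, X_r]`. -/
abbrev P (r : ℕ) : Type := MvPolynomial (Fin (r + 1)) ℂ

/-- The standard grading of the polynomial ring. -/
abbrev gradP (r : ℕ) : ℕ → Submodule ℂ (P r) := homogeneousSubmodule (Fin (r + 1)) ℂ

instance (r : ℕ) : GradedAlgebra (gradP r) := MvPolynomial.gradedAlgebra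

/-- The underlying topological space of the projective space `ℙ^r = Proj ℂ[X₀, …, X_r]`. -/
abbrev ProjSpace (r : ℕ) : TopCat.{0} := ProjectiveSpectrum.top (gradP r)

/-- Sheaves of abelian groups on `ℙ^r`. -/
abbrev AbSheaf (r : ℕ) : Type 1 :=
  CategoryTheory.Sheaf (Opens.grothendieckTopology (ProjSpace r)) AddCommGrpCat.{0}

variable {r : ℕ}

/-- The multiplicative set of polynomials outside the homogeneous prime `x`. -/
abbrev compl (x : ProjectiveSpectrum (gradP r)) : Submonoid (P r) :=
  x.asHomogeneousIdeal.toIdeal.primeCompl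

/-! ### The sheaf associated with a graded module -/

section Assoc

variable {M N : Type} [AddCommGroup M] [Module (P r) M] [AddCommGroup N] [Module (P r) N]

variable (r) in
/-- The family `𝓜` of additive subgroups (the homogeneous pieces of the module `M`) is compatible
with multiplication by homogeneous polynomials. -/
class GradedPieces (𝓜 : ℤ → AddSubgroup M) : Prop where
  smul_mem : ∀ {i : ℕ} {j : ℤ} {a : P r} {m : M}, a ∈ gradP r i → m ∈ 𝓜 j → a • m ∈ 𝓜 (j + i)

/-- A family of germs over `U` is a fraction `m / s` with `s` homogeneous of some degree `i` and
without zeros on `U`, and `m` homogeneous of degree `k + i`. -/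
def IsFrac (𝓜 : ℤ → AddSubgroup M) (k : ℤ) {U : Opens (ProjSpace r)}
    (f : ∀ x : U, LocalizedModule (compl x.1) M) : Prop :=
  ∃ (i : ℕ) (m : M) (s : P r) (_ : m ∈ 𝓜 (k + i)) (_ : s ∈ gradP r i)
    (hs : ∀ x : U, s ∈ compl x.1), ∀ x : U, f x = LocalizedModule.mk m ⟨s, hs x⟩

/-- Being locally a fraction of degree `k`. -/
def isLocFrac (𝓜 : ℤ → AddSubgroup M) (k : ℤ) :
    TopCat.LocalPredicate fun x : ProjSpace r => LocalizedModule (compl x) M :=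
  TopCat.PrelocalPredicate.sheafify
    { pred := fun f => IsFrac 𝓜 k f
      res := by
        rintro V U i f ⟨j, m, s, hm, hs, hx, h⟩
        exact ⟨j, m, s, hm, hs, fun x => hx (i x), fun x => h (i x)⟩ }

/-- Sections over `U` of the `k`-th twist of the sheaf associated with `M`. -/
def sections (𝓜 : ℤ → AddSubgroup M) [GradedPieces r 𝓜] (k : ℤ) (U : Opens (ProjSpace r)) :
    AddSubgroup (∀ x : U, LocalizedModule (compl x.1) M) where
  carrier := {f | (isLocFrac 𝓜 k).pred f}
  zero_mem' := fun x => ⟨U, x.2, 𝟙 U, 0, 0, 1, (𝓜 _).zero_mem, SetLike.one_mem_graded _,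
    fun x => (compl x.1).one_mem, fun x => (LocalizedModule.zero_mk _).symm⟩
  neg_mem' := by
    intro f hf x
    obtain ⟨V, hV, ι, i, m, s, hm, hs, hx, h⟩ := hf x
    refine ⟨V, hV, ι, i, -m, s, (𝓜 _).neg_mem hm, hs, hx, fun y => ?_⟩
    have := h y
    rw [LocalizedModule.mk_neg, ← this]; rfl
  add_mem' := by
    intro f g hf hg x
    obtain ⟨V, hV, ι, i, m, s, hm, hs, hx, h⟩ := hf x
    obtain ⟨W, hW, κ, j, n, t, hn, ht, hy, h'⟩ := hg x
    refine ⟨V ⊓ W, ⟨hV, hW⟩, Opens.infLELeft V W ≫ ι, i + j, t • m + s • n, s * t,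
      (𝓜 _).add_mem ?_ ?_, SetLike.mul_mem_graded hs ht,
      fun z => (compl z.1).mul_mem (hx ⟨z.1, z.2.1⟩) (hy ⟨z.1, z.2.2⟩), fun z => ?_⟩
    · have := GradedPieces.smul_mem ht hm
      rwa [add_assoc, ← Nat.cast_add] at this
    · have := GradedPieces.smul_mem hs hn
      rwa [add_assoc, ← Nat.cast_add, add_comm j i] at this
    · have h1 := h ⟨z.1, z.2.1⟩
      have h2 := h' ⟨z.1, z.2.2⟩
      have h3 := LocalizedModule.mk_add_mk (m1 := m) (m2 := n)
        (s1 := (⟨s, hx ⟨z.1, z.2.1⟩⟩ : compl z.1)) (s2 := ⟨t, hy ⟨z.1, z.2.2⟩⟩)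
      refine Eq.trans ?_ h3
      rw [← h1, ← h2]; rfl

/-- The presheaf of sections of the `k`-th twist of the sheaf associated with `M`. -/
def assocPresheaf (𝓜 : ℤ → AddSubgroup M) [GradedPieces r 𝓜] (k : ℤ) :
    TopCat.Presheaf AddCommGrpCat.{0} (ProjSpace r) where
  obj U := AddCommGrpCat.of (sections 𝓜 k U.unop)
  map {U V} i := AddCommGrpCat.ofHom
    { toFun := fun f => ⟨fun x => f.1 (i.unop x), (isLocFrac 𝓜 k).res i.unop f.1 f.2⟩
      map_zero' := rfl
      map_add' := fun _ _ => rfl }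

/-- The sheaf `M(k)^~` on `ℙ^r` associated with the `k`-th twist of the graded module `M`
(with homogeneous pieces `𝓜`): its sections over `U` are the families of germs that are locally
fractions `m / s` with `m ∈ M` and `s` homogeneous polynomials, `deg m - deg s = k`. -/
def assoc (𝓜 : ℤ → AddSubgroup M) [GradedPieces r 𝓜] (k : ℤ) : AbSheaf r :=
  ⟨assocPresheaf 𝓜 k,
    (TopCat.Presheaf.isSheaf_iff_isSheaf_comp (forget AddCommGrpCat) _).mpr
      (TopCat.Presheaf.isSheaf_of_iso
        (NatIso.ofComponents (fun _ => Iso.refl _) (by cat_disch) :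
          (TopCat.subsheafToTypes (isLocFrac 𝓜 k)).1 ≅ assocPresheaf 𝓜 k ⋙ forget AddCommGrpCat)
        (TopCat.subsheafToTypes (isLocFrac 𝓜 k)).property)⟩

/-- The morphism of sheaves `M(k)^~ ⟶ N(l)^~` induced by a linear map `M → N` that maps
homogeneous elements of degree `k + i` to homogeneous elements of degree `l + i`. -/
def assocMap {𝓜 : ℤ → AddSubgroup M} [GradedPieces r 𝓜] {𝓝 : ℤ → AddSubgroup N} [GradedPieces r 𝓝]
    (φ : M →ₗ[P r] N) (k l : ℤ) (hφ : ∀ i, ∀ m ∈ 𝓜 (k + i), φ m ∈ 𝓝 (l + i)) :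
    (assoc 𝓜 k : AbSheaf r) ⟶ assoc 𝓝 l :=
  ⟨{ app := fun U => AddCommGrpCat.ofHom
      { toFun := fun f => ⟨fun x => LocalizedModule.map (compl x.1) φ (f.1 x), by
          intro x
          obtain ⟨V, hV, ι, i, m, s, hm, hs, hx, h⟩ := f.2 x
          refine ⟨V, hV, ι, i, φ m, s, hφ i m hm, hs, hx, fun y => ?_⟩
          have := h y
          dsimp only at this ⊢
          rw [this, LocalizedModule.map_mk]⟩
        map_zero' := by ext x; exact map_zero _
        map_add' := fun f g => by ext x; exact map_add _ _ _ }
     naturality := by intros; rfl }⟩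

/-- The global section of `M(k)^~` defined by a homogeneous element of `M` of degree `k`. -/
def assocSection (𝓜 : ℤ → AddSubgroup M) [GradedPieces r 𝓜] (k : ℤ) (m : M) (hm : m ∈ 𝓜 k) :
    (assoc 𝓜 k : AbSheaf r).obj.obj (op ⊤) :=
  (⟨fun _ => LocalizedModule.mk m 1, fun x => ⟨⊤, trivial, 𝟙 _, 0, m, 1, by simpa using hm,
    SetLike.one_mem_graded _, fun x => (compl x.1).one_mem, fun _ => rfl⟩⟩ : sections 𝓜 k ⊤)

/-- Multiplication by a homogeneous polynomial `g` of degree `j`, as a map `M(k)^~ ⟶ M(l)^~`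
with `l = k + j`. -/
def assocMul (𝓜 : ℤ → AddSubgroup M) [GradedPieces r 𝓜] {j : ℕ} (g : gradP r j) (k l : ℤ)
    (h : k + j = l) : (assoc 𝓜 k : AbSheaf r) ⟶ assoc 𝓜 l :=
  assocMap (LinearMap.lsmul (P r) M g.1) k l (by
    intro i m hm
    have := GradedPieces.smul_mem g.2 hm
    rw [← h]
    convert! this using 2
    ring)

/-- The homogeneous pieces of a quotient of a graded module. -/
def quotPiece (𝓜 : ℤ → AddSubgroup M) (K : Submodule (P r) M) (j : ℤ) : AddSubgroup (M ⧸ K) :=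
  (𝓜 j).map K.mkQ.toAddMonoidHom

/-- The homogeneous pieces of a submodule of a graded module. -/
def subPiece (𝓜 : ℤ → AddSubgroup M) (K : Submodule (P r) M) (j : ℤ) : AddSubgroup K :=
  (𝓜 j).comap K.subtype.toAddMonoidHom

instance (𝓜 : ℤ → AddSubgroup M) [GradedPieces r 𝓜] (K : Submodule (P r) M) :
    GradedPieces r (quotPiece 𝓜 K) where
  smul_mem := by
    rintro i j a _ ha ⟨m, hm, rfl⟩
    exact ⟨a • m, GradedPieces.smul_mem ha hm, rfl⟩

instance (𝓜 : ℤ → AddSubgroup M) [GradedPieces r 𝓜] (K : Submodule (P r) M) :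
    GradedPieces r (subPiece 𝓜 K) where
  smul_mem := fun {_ _ _ m} ha hm => GradedPieces.smul_mem (m := (m : M)) ha hm

end Assoc

/-! ### The graded modules of the construction -/

/-- The homogeneous polynomials of degree `j ∈ ℤ` (only `0` when `j < 0`). -/
def polyPiece (r : ℕ) (j : ℤ) : AddSubgroup (P r) where
  carrier := {p | p = 0 ∨ ∃ n : ℕ, (n : ℤ) = j ∧ p.IsHomogeneous n}
  zero_mem' := Or.inl rfl
  neg_mem' := by
    rintro p (rfl | ⟨n, hn, hp⟩)
    · exact Or.inl neg_zero
    · exact Or.inr ⟨n, hn, hp.neg⟩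
  add_mem' := by
    rintro p q (rfl | ⟨n, hn, hp⟩) hq
    · rwa [zero_add]
    · rcases hq with rfl | ⟨m, hm, hq⟩
      · rw [add_zero]; exact Or.inr ⟨n, hn, hp⟩
      · obtain rfl : n = m := by omega
        exact Or.inr ⟨n, hn, hp.add hq⟩

instance : GradedPieces r (polyPiece r) where
  smul_mem := by
    rintro i j a m ha (rfl | ⟨n, hn, hm⟩)
    · exact Or.inl (smul_zero _)
    · refine Or.inr ⟨i + n, by push_cast; omega, ?_⟩
      exact ((mem_homogeneousSubmodule i a).1 ha).mul hm

/-- Degree `j` homogeneous vector fields `∑ Aᵢ ∂/∂Xᵢ` on affine space: the coefficients `Aᵢ` are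
homogeneous of degree `j + 1`, so that the associated sheaf is `𝒪(1)^{r+1}`. -/
def fieldPiece (r : ℕ) (j : ℤ) : AddSubgroup (Fin (r + 1) → P r) where
  carrier := {A | ∀ i, A i ∈ polyPiece r (j + 1)}
  zero_mem' := fun _ => (polyPiece r _).zero_mem
  neg_mem' := fun h i => (polyPiece r _).neg_mem (h i)
  add_mem' := fun h h' i => (polyPiece r _).add_mem (h i) (h' i)

instance : GradedPieces r (fieldPiece r) where
  smul_mem := by
    intro i j a A ha hA l
    have := GradedPieces.smul_mem ha (hA l)
    rwa [add_right_comm] at this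

/-- The multiples of the Euler vector field `∑ Xᵢ ∂/∂Xᵢ`. -/
def eulerSpan (r : ℕ) : Submodule (P r) (Fin (r + 1) → P r) := Submodule.span (P r) {fun i => X i}

/-- The sheaf `T_{ℙ^r}(k)`: by the Euler sequence `0 → 𝒪 → 𝒪(1)^{r+1} → T_{ℙ^r} → 0` it is
associated with the graded module of polynomial vector fields modulo the Euler vector field. -/
abbrev tangentSheaf (r : ℕ) (k : ℤ) : AbSheaf r := assoc (quotPiece (fieldPiece r) (eulerSpan r)) k

/-- The gradient ideal `J(f)`. -/
def gradientIdeal (f : P r) : Ideal (P r) := Ideal.span (Set.range fun i => pderiv i f)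

/-- The jacobian ring `R(f) = P / J(f)`. -/
abbrev JacobianRing (f : P r) : Type := P r ⧸ gradientIdeal f

/-- The `0`-th local cohomology `H⁰_𝔪(R(f))`: the elements of the jacobian ring annihilated by some
power of the irrelevant ideal `𝔪 = (X₀, …, X_r)`. -/
def localCohomZero (f : P r) : Submodule (P r) (JacobianRing f) where
  carrier := {x | ∃ n : ℕ, ∀ a ∈ Ideal.span (Set.range (X : Fin (r + 1) → P r)) ^ n, a • x = 0}
  zero_mem' := ⟨0, fun _ _ => smul_zero _⟩
  add_mem' := by
    rintro x y ⟨n, hx⟩ ⟨m, hy⟩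
    refine ⟨n + m, fun a ha => ?_⟩
    rw [smul_add, hx a (Ideal.pow_le_pow_right (Nat.le_add_right n m) ha),
      hy a (Ideal.pow_le_pow_right (Nat.le_add_left m n) ha), add_zero]
  smul_mem' := by
    rintro c x ⟨n, hx⟩
    refine ⟨n, fun a ha => ?_⟩
    rw [smul_comm, hx a ha, smul_zero]

/-- The homogeneous coordinate ring `P / (f)` of `X = V(f)`, as a `P`-module. -/
abbrev CoordRing (f : P r) : Type := P r ⧸ (Ideal.span {f} : Submodule (P r) (P r))

/-- The sheaf `𝒪_X(k)`. -/
abbrev structSheafX (f : P r) (k : ℤ) : AbSheaf r :=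
  assoc (quotPiece (polyPiece r) (Ideal.span {f} : Submodule (P r) (P r))) k

/-- The global section of `𝒪_X(k)` defined by a homogeneous polynomial of degree `k`. -/
def polySection (f : P r) (k : ℤ) (a : P r) (ha : a ∈ polyPiece r k) :
    (structSheafX f k).obj.obj (op ⊤) :=
  assocSection (quotPiece (polyPiece r) (Ideal.span {f} : Submodule (P r) (P r))) k
    (Submodule.Quotient.mk a) ⟨a, ha, rfl⟩

/-- The image of `J(f)` in the coordinate ring of `X`. -/
def jacobianModule (f : P r) : Submodule (P r) (CoordRing f) :=
  Submodule.map (Submodule.mkQ (Ideal.span {f} : Submodule (P r) (P r))) (gradientIdeal f)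

/-- The homogeneous pieces of the image of `J(f)` in the coordinate ring of `X`. -/
abbrev jacobianPiece (f : P r) : ℤ → AddSubgroup (jacobianModule f) :=
  subPiece (quotPiece (polyPiece r) (Ideal.span {f} : Submodule (P r) (P r))) (jacobianModule f)

/-- The twists `𝒥_{f/X}(k)` of the jacobian ideal sheaf `𝒥_{f/X} ⊆ 𝒪_X`. -/
abbrev jacobianSheafX (f : P r) (k : ℤ) : AbSheaf r := assoc (jacobianPiece f) k

/-- The group of global sections `H⁰(𝒥_{f/X}(k))`. -/
abbrev H0Jacobian (f : P r) (k : ℤ) : Type := (jacobianSheafX f k).obj.obj (op ⊤)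

/-- The inclusion `𝒥_{f/X}(k) ⟶ 𝒪_X(k)`. -/
def jacobianIncl (f : P r) (k : ℤ) : jacobianSheafX f k ⟶ structSheafX f k :=
  assocMap (jacobianModule f).subtype k k (fun _ _ hm => hm)

/-- The map on global sections `H⁰(𝒥_{f/X}(k)) → H⁰(𝒪_X(k))` induced by the inclusion. -/
def H0JacobianIncl (f : P r) (k : ℤ) (s : H0Jacobian f k) : (structSheafX f k).obj.obj (op ⊤) :=
  (jacobianIncl f k).hom.app (op ⊤) s

/-- The `P`-linear map `∑ Aᵢ ∂/∂Xᵢ ↦ ∑ Aᵢ ∂f/∂Xᵢ`. -/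
def gradPairing (f : P r) : (Fin (r + 1) → P r) →ₗ[P r] P r :=
  ∑ i, (LinearMap.proj i : (Fin (r + 1) → P r) →ₗ[P r] P r).smulRight (pderiv i f)

lemma gradPairing_apply (f : P r) (A : Fin (r + 1) → P r) :
    gradPairing f A = ∑ i, A i * pderiv i f := by
  simp [gradPairing]

lemma gradPairing_mem (f : P r) (A : Fin (r + 1) → P r) : gradPairing f A ∈ gradientIdeal f := by
  rw [gradPairing_apply]
  exact Ideal.sum_mem _ fun i _ => Ideal.mul_mem_left _ _ (Ideal.subset_span ⟨i, rfl⟩)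

variable {d : ℕ} {f : P r}

/-- The `P`-linear map underlying `η`, from polynomial vector fields modulo the Euler vector field
to `J(f)` modulo `f`, `∑ Aᵢ ∂/∂Xᵢ ↦ ∑ Aᵢ ∂f/∂Xᵢ`. It is well defined by Euler's formula. -/
def etaLin (hf : f.IsHomogeneous d) :
    ((Fin (r + 1) → P r) ⧸ eulerSpan r) →ₗ[P r] jacobianModule f :=
  Submodule.liftQ (eulerSpan r)
    (LinearMap.codRestrict (jacobianModule f)
      ((Submodule.mkQ (Ideal.span {f} : Submodule (P r) (P r))).comp (gradPairing f))
      (fun A => ⟨_, gradPairing_mem f A, rfl⟩))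
    (by
      rw [eulerSpan, Submodule.span_le, Set.singleton_subset_iff]
      refine Subtype.ext ?_
      refine (Submodule.Quotient.mk_eq_zero _).2 ?_
      rw [gradPairing_apply, hf.sum_X_mul_pderiv, nsmul_eq_mul]
      exact Ideal.mul_mem_left _ _ (Ideal.mem_span_singleton_self f))

lemma etaLin_mk (hf : f.IsHomogeneous d) (A : Fin (r + 1) → P r) :
    (etaLin hf (Submodule.Quotient.mk A)).1 = Submodule.Quotient.mk (gradPairing f A) := rfl

lemma gradPairing_deg (hf : f.IsHomogeneous d) (j : ℤ) {A : Fin (r + 1) → P r}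
    (hA : A ∈ fieldPiece r j) : gradPairing f A ∈ polyPiece r (j + d) := by
  rw [gradPairing_apply]
  refine AddSubgroup.sum_mem _ fun i _ => ?_
  rcases Nat.eq_zero_or_pos d with rfl | hd
  · rw [totalDegree_eq_zero_iff_eq_C.1 (Nat.le_zero.1 hf.totalDegree_le), pderiv_C, mul_zero]
    exact AddSubgroup.zero_mem _
  · rcases hA i with h | ⟨n, hn, h⟩
    · rw [h, zero_mul]; exact AddSubgroup.zero_mem _
    · exact Or.inr ⟨n + (d - 1), by omega, h.mul hf.pderiv⟩

lemma etaLin_deg (hf : f.IsHomogeneous d) (j l : ℤ) (h : j + d = l)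
    (m : (Fin (r + 1) → P r) ⧸ eulerSpan r) (hm : m ∈ quotPiece (fieldPiece r) (eulerSpan r) j) :
    etaLin hf m ∈ jacobianPiece f l := by
  obtain ⟨A, hA, rfl⟩ := hm
  subst h
  exact ⟨gradPairing f A, gradPairing_deg hf j hA, rfl⟩

/-- In each degree, `η` is onto on the level of graded modules. -/
lemma etaLin_surj (hf : f.IsHomogeneous d) (j l : ℤ) (h : j + d = l) (m : jacobianModule f)
    (hm : m ∈ jacobianPiece f l) :
    ∃ t ∈ quotPiece (fieldPiece r) (eulerSpan r) j, etaLin hf t = m := by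
  classical
  obtain ⟨m, hmem⟩ := m
  obtain ⟨g, hg, rfl⟩ := hm
  rcases hg with rfl | ⟨n, hn, hg⟩
  · exact ⟨0, AddSubgroup.zero_mem _, Subtype.ext (by rw [map_zero]; exact (map_zero _).symm)⟩
  obtain ⟨u, hu, hug⟩ := hmem
  obtain ⟨A, rfl⟩ : ∃ A, gradPairing f A = u := by
    obtain ⟨c, hc⟩ := (Ideal.mem_span_range_iff_exists_fun).1 hu
    exact ⟨c, by rw [gradPairing_apply, hc]⟩
  obtain ⟨b, hb⟩ : ∃ b, b * f = gradPairing f A - g :=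
    Ideal.mem_span_singleton'.1 ((Submodule.Quotient.eq _).1 hug)
  -- compare the components of degree `n`
  have hdf : f ∈ gradP r d := hf
  have hgd : ((DirectSum.decompose (gradP r) g n : gradP r n) : P r) = g :=
    DirectSum.decompose_of_mem_same (gradP r) hg
  have hcomp : ((DirectSum.decompose (gradP r) (b * f) n : gradP r n) : P r) =
      (∑ i, ((DirectSum.decompose (gradP r) (A i * pderiv i f) n : gradP r n) : P r)) - g := by
    rw [hb, gradPairing_apply, DirectSum.decompose_sub, DirectSum.decompose_sum]
    simp only [DirectSum.sub_apply, AddSubgroupClass.coe_sub, hgd]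
    congr 1
    simp
  have hbf : ((DirectSum.decompose (gradP r) (b * f) n : gradP r n) : P r) ∈ Ideal.span {f} := by
    rw [DirectSum.coe_decompose_mul_of_right_mem (gradP r) n hdf]
    split_ifs
    · exact Ideal.mul_mem_left _ _ (Ideal.mem_span_singleton_self f)
    · exact Ideal.zero_mem _
  rcases Nat.eq_zero_or_pos d with rfl | hd
  · refine ⟨0, AddSubgroup.zero_mem _, Subtype.ext ?_⟩
    rw [map_zero]
    refine ((Submodule.Quotient.mk_eq_zero _).2 ?_).symm
    have h0 : gradPairing f A = 0 := by
      rw [gradPairing_apply]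
      refine Finset.sum_eq_zero fun i _ => ?_
      rw [totalDegree_eq_zero_iff_eq_C.1 (Nat.le_zero.1 hf.totalDegree_le), pderiv_C, mul_zero]
    rw [h0, zero_sub] at hb
    rw [← neg_neg g, ← hb]
    exact Submodule.neg_mem _ (Ideal.mul_mem_left _ _ (Ideal.mem_span_singleton_self f))
  let B : Fin (r + 1) → P r := fun i =>
    if d - 1 ≤ n then (DirectSum.decompose (gradP r) (A i) (n - (d - 1)) : gradP r _) else 0
  have hB : gradPairing f B = g + (DirectSum.decompose (gradP r) (b * f) n : gradP r n) := by
    rw [hcomp, gradPairing_apply, add_sub_cancel]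
    refine Finset.sum_congr rfl fun i _ => ?_
    rw [DirectSum.coe_decompose_mul_of_right_mem (gradP r) n (i := d - 1) hf.pderiv]
    simp only [B]
    split_ifs <;> simp
  refine ⟨Submodule.Quotient.mk B, ⟨B, fun i => ?_, rfl⟩, Subtype.ext ?_⟩
  · simp only [B]
    split_ifs with hle
    · refine Or.inr ⟨n - (d - 1), by omega,
        (DirectSum.decompose (gradP r) (A i) (n - (d - 1))).2⟩
    · exact Or.inl rfl
  · rw [etaLin_mk, hB]
    refine (Submodule.Quotient.eq _).2 ?_
    rwa [add_sub_cancel_left]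

/-- The morphism `η : T_{ℙ^r}(k - d) ⟶ 𝒥_{f/X}(k)`, `∑ Aᵢ ∂/∂Xᵢ ↦ ∑ Aᵢ ∂f/∂Xᵢ`. -/
def eta (hf : f.IsHomogeneous d) (k : ℤ) : tangentSheaf r (k - d) ⟶ jacobianSheafX f k :=
  assocMap (etaLin hf) (k - d) k fun i m hm => etaLin_deg hf _ _ (by ring) m hm

instance (hf : f.IsHomogeneous d) (k : ℤ) : Epi (eta hf k) := by
  refine (TopCat.Sheaf.isLocallySurjective_iff_epi (eta hf k)).1 ?_
  refine (TopCat.Presheaf.isLocallySurjective_iff _).2 fun U t x hx => ?_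
  obtain ⟨V, hV, ι, i, m, s, hm, hs, hy, h⟩ := t.2 ⟨x, hx⟩
  obtain ⟨t', ht', rfl⟩ := etaLin_surj hf (k - d + i) (k + i) (by ring) m hm
  refine ⟨V, ι.le, ⟨⟨fun y => LocalizedModule.mk t' ⟨s, hy y⟩, fun y =>
    ⟨V, y.2, 𝟙 V, i, t', s, ht', hs, hy, fun _ => rfl⟩⟩, ?_⟩, hV⟩
  refine Subtype.ext (funext fun y => ?_)
  refine Eq.trans ?_ (h y).symm
  exact LocalizedModule.map_mk (S := compl y.1) (etaLin hf) t' ⟨s, hy y⟩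

/-- The sheaf `T⟨X⟩(k - d)`, where `T⟨X⟩ = ker (η : T_{ℙ^r} → 𝒥_{f/X}(d))` is the sheaf of
logarithmic vector fields along `X = V(f)`. -/
def logSheaf (hf : f.IsHomogeneous d) (k : ℤ) : AbSheaf r := Limits.kernel (eta hf k)

/-- The inclusion `T⟨X⟩(k - d) ⟶ T_{ℙ^r}(k - d)`. -/
def logIncl (hf : f.IsHomogeneous d) (k : ℤ) : logSheaf hf k ⟶ tangentSheaf r (k - d) :=
  Limits.kernel.ι (eta hf k)

instance (hf : f.IsHomogeneous d) (k : ℤ) : Mono (logIncl hf k) :=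
  inferInstanceAs (Mono (Limits.kernel.ι (eta hf k)))

/-- The exact sequence `0 → T⟨X⟩(k - d) → T_{ℙ^r}(k - d) → 𝒥_{f/X}(k) → 0`. -/
def logSeq (hf : f.IsHomogeneous d) (k : ℤ) : ShortComplex (AbSheaf r) :=
  ShortComplex.mk (logIncl hf k) (eta hf k) (Limits.kernel.condition _)

lemma logSeq_shortExact (hf : f.IsHomogeneous d) (k : ℤ) : (logSeq hf k).ShortExact where
  exact := ShortComplex.exact_kernel _
  mono_f := inferInstanceAs (Mono (logIncl hf k))
  epi_g := inferInstanceAs (Epi (eta hf k))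

/-! ### The graded module `H¹_*(T⟨X⟩(-d))` -/

/-- The cohomology group `H¹(ℙ^r, T⟨X⟩(k - d))`. -/
abbrev H1Log (hf : f.IsHomogeneous d) (k : ℤ) : Type := Sheaf.H (logSheaf hf k) 1

/-- The connecting homomorphism `H⁰(𝒥_{f/X}(k)) → H¹(T⟨X⟩(k - d))`. -/
def connecting (hf : f.IsHomogeneous d) (k : ℤ) (s : H0Jacobian f k) :
    H1Log hf k :=
  ((Sheaf.H.equiv₀ (jacobianSheafX f k) Limits.isTerminalTop).symm s).comp
    (logSeq_shortExact hf k).extClass (zero_add 1)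

lemma eta_mul (hf : f.IsHomogeneous d) {j : ℕ} (g : gradP r j) (k l : ℤ) (h : k + j = l) :
    eta hf k ≫ assocMul (jacobianPiece f) g k l h =
      assocMul (quotPiece (fieldPiece r) (eulerSpan r)) g (k - d) (l - d) (by omega) ≫
        eta hf l := by
  ext U t
  refine Subtype.ext (funext fun x => ?_)
  change LocalizedModule.map (compl x.1) (LinearMap.lsmul (P r) _ g.1)
      (LocalizedModule.map (compl x.1) (etaLin hf) (t.1 x)) =
    LocalizedModule.map (compl x.1) (etaLin hf)
      (LocalizedModule.map (compl x.1) (LinearMap.lsmul (P r) _ g.1) (t.1 x))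
  induction t.1 x using LocalizedModule.induction_on with
  | h m s => simp [LocalizedModule.map_mk]

/-- Multiplication `T⟨X⟩(k - d) ⟶ T⟨X⟩(l - d)` by a homogeneous polynomial of degree
`j = l - k`. -/
def logMul (hf : f.IsHomogeneous d) {j : ℕ} (g : gradP r j) (k l : ℤ) (h : k + j = l) :
    logSheaf hf k ⟶ logSheaf hf l :=
  Limits.kernel.map (eta hf k) (eta hf l)
    (assocMul (quotPiece (fieldPiece r) (eulerSpan r)) g (k - d) (l - d) (by omega))
    (assocMul (jacobianPiece f) g k l h) (eta_mul hf g k l h)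

lemma logMul_ι (hf : f.IsHomogeneous d) {j : ℕ} (g : gradP r j) (k l : ℤ) (h : k + j = l) :
    logMul hf g k l h ≫ logIncl hf l = logIncl hf k ≫
      assocMul (quotPiece (fieldPiece r) (eulerSpan r)) g (k - d) (l - d) (by omega) :=
  Limits.kernel.lift_ι _ _ _

/-- The action of a homogeneous polynomial on the cohomology groups `H¹(T⟨X⟩(k - d))`. -/
def logAct (hf : f.IsHomogeneous d) {j : ℕ} (g : gradP r j) (k l : ℤ) (h : k + j = l) :
    H1Log hf k →+ H1Log hf l :=
  Sheaf.H.map (logMul hf g k l h) 1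

section Action

variable {M : Type} [AddCommGroup M] [Module (P r) M] (𝓜 : ℤ → AddSubgroup M) [GradedPieces r 𝓜]

lemma assocMul_add {j : ℕ} (g g' : gradP r j) (k l : ℤ) (h : k + j = l) :
    assocMul 𝓜 (g + g') k l h = assocMul 𝓜 g k l h + assocMul 𝓜 g' k l h := by
  ext U t
  refine Subtype.ext (funext fun x => ?_)
  change LocalizedModule.map (compl x.1) (LinearMap.lsmul (P r) M (g.1 + g'.1)) (t.1 x) =
    LocalizedModule.map (compl x.1) (LinearMap.lsmul (P r) M g.1) (t.1 x) +
    LocalizedModule.map (compl x.1) (LinearMap.lsmul (P r) M g'.1) (t.1 x)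
  simp

lemma assocMul_one (e : gradP r 0) (he : e.1 = 1) (k : ℤ) (h : k + (0 : ℕ) = k) :
    assocMul 𝓜 e k k h = 𝟙 _ := by
  ext U t
  refine Subtype.ext (funext fun x => ?_)
  change LocalizedModule.map (compl x.1) (LinearMap.lsmul (P r) M e.1) (t.1 x) = t.1 x
  rw [he]
  induction t.1 x using LocalizedModule.induction_on with
  | h m s => simp [LocalizedModule.map_mk]

lemma assocMul_mul {i j : ℕ} (g : gradP r i) (g' : gradP r j) (e : gradP r (i + j))
    (he : e.1 = g.1 * g'.1) (k l l' : ℤ) (h : k + j = l)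
    (h' : l + i = l') (h'' : k + (i + j : ℕ) = l') :
    assocMul 𝓜 e k l' h'' =
      assocMul 𝓜 g' k l h ≫ assocMul 𝓜 g l l' h' := by
  ext U t
  refine Subtype.ext (funext fun x => ?_)
  change LocalizedModule.map (compl x.1) (LinearMap.lsmul (P r) M e.1) (t.1 x) =
    LocalizedModule.map (compl x.1) (LinearMap.lsmul (P r) M g.1)
      (LocalizedModule.map (compl x.1) (LinearMap.lsmul (P r) M g'.1) (t.1 x))
  induction t.1 x using LocalizedModule.induction_on with
  | h m s => simp only [LocalizedModule.map_mk, he, LinearMap.lsmul_apply, mul_smul]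

end Action

lemma logAct_add (hf : f.IsHomogeneous d) {j : ℕ} (g g' : gradP r j) (k l : ℤ) (h : k + j = l) :
    logAct hf (g + g') k l h = logAct hf g k l h + logAct hf g' k l h := by
  ext c
  have : logMul hf (g + g') k l h = logMul hf g k l h + logMul hf g' k l h := by
    rw [← cancel_mono (logIncl hf l), Preadditive.add_comp, logMul_ι, logMul_ι,
      logMul_ι, assocMul_add, Preadditive.comp_add]
  simp [logAct, this]

lemma logAct_one (hf : f.IsHomogeneous d) (e : gradP r 0) (he : e.1 = 1) (k : ℤ) (h : k + (0 : ℕ) = k) (c : H1Log hf k) :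
    logAct hf e k k h c = c := by
  have : logMul hf e k k h = 𝟙 _ := by
    rw [← cancel_mono (logIncl hf k), logMul_ι, assocMul_one _ _ he, Category.id_comp]
    exact Category.comp_id _
  simp [logAct, this]

lemma logAct_mul (hf : f.IsHomogeneous d) {i j : ℕ} (g : gradP r i) (g' : gradP r j)
    (e : gradP r (i + j)) (he : e.1 = g.1 * g'.1) (k l l' : ℤ) (h : k + j = l) (h' : l + i = l') (h'' : k + (i + j : ℕ) = l')
    (c : H1Log hf k) :
    logAct hf e k l' h'' c =
      logAct hf g l l' h' (logAct hf g' k l h c) := by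
  have : logMul hf e k l' h'' =
      logMul hf g' k l h ≫ logMul hf g l l' h' := by
    rw [← cancel_mono (logIncl hf l'), Category.assoc, logMul_ι, logMul_ι,
      ← Category.assoc, logMul_ι, Category.assoc, assocMul_mul _ _ _ _ he _ (l - d) _ (by omega)
        (by omega)]
  rw [logAct, this, Sheaf.H.map_comp_apply]; rfl

/-- The action of `ℕ` on `ℤ` by translation, used to index graded modules. -/
abbrev shiftVAdd : VAdd ℕ ℤ := ⟨fun n k => k + n⟩

attribute [local instance] shiftVAdd

instance (hf : f.IsHomogeneous d) :
    DirectSum.Gmodule (fun n => gradP r n) (fun k => H1Log hf k) where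
  smul {j k} g c := logAct hf g k (j +ᵥ k) rfl c
  one_smul := by
    rintro ⟨k, c⟩
    have key : ∀ (l : ℤ) (h : k + (0 : ℕ) = l),
        (⟨l, logAct hf (GradedMonoid.GOne.one (A := fun n => gradP r n)) k l h c⟩ :
          GradedMonoid fun k => H1Log hf k) = ⟨k, c⟩ := by
      intro l h
      obtain rfl : l = k := by simpa using h.symm
      rw [logAct_one hf _ rfl]
    exact key _ rfl
  mul_smul := by
    rintro ⟨i, g⟩ ⟨j, g'⟩ ⟨k, c⟩
    have key : ∀ (l : ℤ) (h : k + (i + j : ℕ) = l),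
        (⟨l, logAct hf (GradedMonoid.GMul.mul (A := fun n => gradP r n) g g') k l h c⟩ :
          GradedMonoid fun k => H1Log hf k) =
          ⟨k + j + i, logAct hf g (k + j) (k + j + i) rfl (logAct hf g' k (k + j) rfl c)⟩ := by
      intro l h
      obtain rfl : l = k + j + i := by rw [← h]; push_cast; ring
      rw [← logAct_mul hf g g' (GradedMonoid.GMul.mul (A := fun n => gradP r n) g g') rfl]
    exact key _ rfl
  smul_add := fun _ _ _ => map_add _ _ _
  smul_zero := fun _ => map_zero _
  add_smul := fun g g' c => by
    rw [logAct_add]; rfl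
  zero_smul := fun {j k} c => by
    have := logAct_add hf (0 : gradP r j) 0 k (j +ᵥ k) rfl
    rw [add_zero, left_eq_add] at this
    rw [this]; rfl

/-- The graded `P`-module `H¹_*(T⟨X⟩(-d)) = ⨁_{k ∈ ℤ} H¹(ℙ^r, T⟨X⟩(k - d))`. -/
def H1StarLog (hf : f.IsHomogeneous d) : Type := ⨁ k : ℤ, H1Log hf k

instance (hf : f.IsHomogeneous d) : AddCommGroup (H1StarLog hf) :=
  inferInstanceAs (AddCommGroup (⨁ k : ℤ, H1Log hf k))

instance (hf : f.IsHomogeneous d) : Module (P r) (H1StarLog hf) :=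
  Module.compHom (⨁ k : ℤ, H1Log hf k)
    (DirectSum.decomposeRingEquiv (gradP r) : P r ≃+* ⨁ n, gradP r n).toRingHom

/-- The inclusion of the summand of degree `k`. -/
def H1StarLog.of (hf : f.IsHomogeneous d) (k : ℤ) : H1Log hf k →+ H1StarLog hf :=
  DirectSum.of (fun k => H1Log hf k) k

/-- Multiplication by a homogeneous polynomial on `H¹_*` is induced by multiplication on sheaves. -/
lemma H1StarLog.smul_of (hf : f.IsHomogeneous d) {j : ℕ} (g : gradP r j) (k l : ℤ)
    (h : k + j = l) (c : H1Log hf k) :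
    (g : P r) • H1StarLog.of hf k c = H1StarLog.of hf l (logAct hf g k l h c) := by
  obtain rfl : l = j +ᵥ k := h.symm
  change DirectSum.decompose (gradP r) (g : P r) • DirectSum.of (fun k => H1Log hf k) k c = _
  rw [DirectSum.decompose_coe]
  have := DirectSum.Gmodule.of_smul_of (fun n => gradP r n) (fun k => H1Log hf k) g c
  refine Eq.trans this ?_
  rfl

/-- The hypersurface `V(f) ⊆ ℙ^r` is nonsingular: at each of its points some partial derivative of
`f` does not vanish. -/
def IsNonsingular (f : P r) : Prop :=
  ∀ x : Fin (r + 1) → ℂ, x ≠ 0 → eval x f = 0 → ∃ i, eval x (pderiv i f) ≠ 0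

end LogSheaf

end

/-
Replace `η` by the pairing `𝒪(1)^{r+1}(k-d) → J(f)^~(k)`. Since `d ≠ 0`, Euler's formula
`∑ᵢ Xᵢ ∂f/∂Xᵢ = d f` shows that a vector field sending `f` into `(f)` lifts uniquely, modulo the
Euler field, to a field on affine space which annihilates `f`. Hence `T⟨X⟩(k-d)` is also the kernel
of the pairing. As `r ≥ 2`, any three variables form a regular sequence, so `H¹(𝒪(k))` vanishes by
a Čech argument, and `H¹_*(T⟨X⟩(-d))` is the cokernel of the pairing on global sections, which is
the quotient of the saturation of `J(f)` by `J(f)`, that is, `H⁰_𝔪(R(f))`.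
-/

noncomputable section

namespace LogSheaf

open CategoryTheory TopologicalSpace Opposite MvPolynomial
open scoped DirectSum

variable {r : ℕ}

/-! ### Regular sequences and the Koszul complex -/

section Koszul

open RingTheory.Sequence
open scoped Pointwise

variable {A M ι : Type*} [CommRing A] [AddCommGroup M] [Module A M] [Finite ι]

lemma exists_smul_eq_smul_of_mem_span {g : ι → A} {y : A}
    (hy : y ∈ Ideal.span (Set.range g)) {c : ι → M} (hc : ∀ i j, g j • c i = g i • c j) :
    ∃ e : M, (∀ i, y • c i = g i • e) ∧
      ∀ (w : A) (p : M), (∀ i, w • c i = g i • p) → w • e = y • p := by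
  have := Fintype.ofFinite ι
  obtain ⟨u, rfl⟩ := Ideal.mem_span_range_iff_exists_fun.1 hy
  refine ⟨∑ k, u k • c k, fun i => ?_, fun w p hp => ?_⟩
  · simp only [Finset.sum_smul, Finset.smul_sum, mul_smul, hc i, smul_comm (g i)]
  · simp only [Finset.sum_smul, Finset.smul_sum, mul_smul, smul_comm w, hp]

lemma exists_eq_smul_of_isWeaklyRegular {g : ι → A} {z w : A}
    (hz : z ∈ Ideal.span (Set.range g)) (hw : w ∈ Ideal.span (Set.range g))
    (hreg : IsWeaklyRegular M [z, w]) {c : ι → M} (hc : ∀ i j, g j • c i = g i • c j) :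
    ∃ β : M, ∀ i, c i = g i • β := by
  obtain ⟨hz_reg, hw_reg⟩ := (isWeaklyRegular_cons_iff M z [w]).1 hreg
  rw [isWeaklyRegular_singleton_iff] at hw_reg
  obtain ⟨p, hp, hpz⟩ := exists_smul_eq_smul_of_mem_span hz hc
  obtain ⟨q, hq, -⟩ := exists_smul_eq_smul_of_mem_span hw hc
  obtain ⟨β, -, rfl⟩ : p ∈ z • (⊤ : Submodule A M) :=
    mem_of_isSMulRegular_quotient_of_smul_mem hw_reg ⟨q, trivial, (hpz w q hq).symm⟩
  exact ⟨β, fun i => hz_reg ((hp i).trans (smul_comm _ _ _))⟩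

lemma exists_koszul_primitive_of_isWeaklyRegular {g : ι → A} {y z w : A}
    (hy : y ∈ Ideal.span (Set.range g)) (hz : z ∈ Ideal.span (Set.range g))
    (hw : w ∈ Ideal.span (Set.range g)) (hreg : IsWeaklyRegular M [y, z, w]) {b : ι → ι → M}
    (hb : ∀ i j k, g i • b j k - g j • b i k + g k • b i j = 0) :
    ∃ c : ι → M, ∀ i j, b i j = g j • c i - g i • c j := by
  obtain ⟨hy_reg, hzw_reg⟩ := (isWeaklyRegular_cons_iff M y [z, w]).1 hreg
  obtain ⟨e, he⟩ : ∃ e : ι → M, ∀ i j, y • b i j = g j • e i - g i • e j := by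
    have := Fintype.ofFinite ι
    obtain ⟨u, rfl⟩ := Ideal.mem_span_range_iff_exists_fun.1 hy
    refine ⟨fun i => ∑ k, u k • b i k, fun i j => ?_⟩
    simp only [Finset.sum_smul, Finset.smul_sum, ← Finset.sum_sub_distrib]
    refine Finset.sum_congr rfl fun k _ => ?_
    linear_combination (norm := module) u k • hb i j k
  obtain ⟨β, hβ⟩ : ∃ β : QuotSMulTop y M, ∀ i, Submodule.Quotient.mk (e i) = g i • β := by
    refine exists_eq_smul_of_isWeaklyRegular hz hw hzw_reg fun i j => ?_
    rw [← Submodule.Quotient.mk_smul, ← Submodule.Quotient.mk_smul, Submodule.Quotient.eq, ← he]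
    exact Submodule.smul_mem_pointwise_smul _ _ _ trivial
  obtain ⟨β, rfl⟩ := Submodule.Quotient.mk_surjective _ β
  have hdiv : ∀ i, ∃ c : M, y • c = e i - g i • β := fun i => by
    obtain ⟨c, -, hc⟩ := (Submodule.Quotient.eq _).1 (hβ i)
    exact ⟨c, hc⟩
  choose c hc using hdiv
  refine ⟨c, fun i j => hy_reg ?_⟩
  simp only [smul_sub, smul_comm y, hc, he]
  rw [smul_comm (g j) (g i)]
  abel

end Koszul

section PowersOfVariables

variable {σ R : Type*} [CommRing R]

lemma mem_span_X_pow_of_X_pow_mul_mem {S : Set σ} {k : σ} (hk : k ∉ S) (N : ℕ)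
    {p : MvPolynomial σ R}
    (h : X k ^ N * p ∈ Ideal.span ((fun i => (X i : MvPolynomial σ R) ^ N) '' S)) :
    p ∈ Ideal.span ((fun i => (X i : MvPolynomial σ R) ^ N) '' S) := by
  classical
  have hS : (fun i => (X i : MvPolynomial σ R) ^ N) '' S =
      (fun s => monomial s (1 : R)) '' ((fun i => Finsupp.single i N) '' S) := by
    simp only [Set.image_image, X_pow_eq_monomial]
  rw [hS, mem_ideal_span_monomial_image] at h ⊢
  intro m hm
  obtain ⟨_, ⟨i, hi, rfl⟩, hle⟩ := h (Finsupp.single k N + m) (by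
    rw [mem_support_iff] at hm ⊢
    rwa [X_pow_eq_monomial, coeff_monomial_mul, one_mul])
  have hik : k ≠ i := by rintro rfl; exact hk hi
  refine ⟨_, ⟨i, hi, rfl⟩, ?_⟩
  rw [Finsupp.single_le_iff] at hle ⊢
  simpa [Finsupp.single_apply, hik] using hle

lemma isWeaklyRegular_X_pow {l : List σ} (hl : l.Nodup) (N : ℕ) :
    RingTheory.Sequence.IsWeaklyRegular (MvPolynomial σ R)
      (l.map fun i => (X i : MvPolynomial σ R) ^ N) where
  regular_mod_prev k hk := by
    have hspan : (Ideal.ofList ((l.map fun i => (X i : MvPolynomial σ R) ^ N).take k) •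
        (⊤ : Submodule (MvPolynomial σ R) (MvPolynomial σ R))) =
        Ideal.span ((fun i => (X i : MvPolynomial σ R) ^ N) '' {i | i ∈ l.take k}) := by
      rw [smul_eq_mul, Ideal.mul_top, Ideal.ofList, ← List.map_take]
      congr 1
      ext
      simp only [List.mem_map, Set.mem_ofPred_eq, Set.mem_image]
    rw [isSMulRegular_quotient_iff_mem_of_smul_mem, hspan]
    intro p hp
    rw [List.getElem_map, smul_eq_mul] at hp
    rw [List.length_map] at hk
    refine mem_span_X_pow_of_X_pow_mul_mem (fun h => ?_) N hp
    obtain ⟨m, hm, hmk⟩ := List.mem_take_iff_getElem.1 h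
    have := (hl.getElem_inj_iff).1 hmk
    omega

end PowersOfVariables

/-! ### Homogeneous elements and points of projective spectra -/

section ProjectiveSpectrum

variable {A σ : Type*} [CommRing A] [SetLike σ A] [AddSubgroupClass σ A] {𝒜 : ℕ → σ}
  [GradedRing 𝒜]

lemma exists_pos_homogeneous_notMem (x : ProjectiveSpectrum 𝒜) :
    ∃ e, 0 < e ∧ ∃ g ∈ 𝒜 e, g ∉ x.asHomogeneousIdeal := by
  by_contra! h
  exact x.not_irrelevant_le ((HomogeneousIdeal.irrelevant_le 𝒜).2 h)

lemma exists_proj_notMem {x : ProjectiveSpectrum 𝒜} {a : A} (ha : a ∉ x.asHomogeneousIdeal) :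
    ∃ n, GradedRing.proj 𝒜 n a ∉ x.asHomogeneousIdeal := by
  rw [← ProjectiveSpectrum.mem_basicOpen, ProjectiveSpectrum.basicOpen_eq_union_of_projection,
    Opens.mem_iSup] at ha
  simpa only [ProjectiveSpectrum.mem_basicOpen] using ha

lemma exists_basicOpen_le_of_mem {U : Opens (ProjectiveSpectrum 𝒜)} {x : ProjectiveSpectrum 𝒜}
    (hx : x ∈ U) :
    ∃ e, 0 < e ∧ ∃ g ∈ 𝒜 e, x ∈ ProjectiveSpectrum.basicOpen 𝒜 g ∧
      ProjectiveSpectrum.basicOpen 𝒜 g ≤ U := by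
  obtain ⟨_, ⟨a, rfl⟩, hxa, haU⟩ :=
    (ProjectiveSpectrum.isTopologicalBasis_basic_opens 𝒜).exists_subset_of_mem_open hx U.2
  obtain ⟨n, hn⟩ := exists_proj_notMem hxa
  obtain ⟨e, he, g, hg, hgx⟩ := exists_pos_homogeneous_notMem x
  refine ⟨n + e, by omega, GradedRing.proj 𝒜 n a * g,
    SetLike.mul_mem_graded (SetLike.coe_mem _) hg, ?_, fun y hy => haU fun hay => ?_⟩
  · rw [ProjectiveSpectrum.basicOpen_mul]
    exact ⟨hn, hgx⟩
  · exact (ProjectiveSpectrum.basicOpen_mul_le_left 𝒜 _ _ hy)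
      (y.asHomogeneousIdeal.isHomogeneous n hay)

lemma mem_radical_of_forall_exists_homogeneous {I : Ideal A} {e : ℕ} (he : 0 < e) {g : A}
    (hg : g ∈ 𝒜 e)
    (h : ∀ x : ProjectiveSpectrum 𝒜, g ∉ x.asHomogeneousIdeal →
      ∃ t ∈ I, SetLike.IsHomogeneousElem 𝒜 t ∧ t ∉ x.asHomogeneousIdeal) :
    g ∈ I.radical := by
  suffices g ∈ (I.homogeneousCore 𝒜).toIdeal.radical from
    Ideal.radical_mono (Ideal.toIdeal_homogeneousCore_le 𝒜 I) this
  rw [(I.homogeneousCore 𝒜).isHomogeneous.radical_eq, Ideal.mem_sInf]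
  rintro Q ⟨hQ, hIQ, hQp⟩
  by_contra hgQ
  have hrel : ¬ HomogeneousIdeal.irrelevant 𝒜 ≤ ⟨Q, hQ⟩ := fun hle =>
    hgQ (hle (HomogeneousIdeal.mem_irrelevant_of_mem 𝒜 he hg))
  obtain ⟨t, htI, ht, htx⟩ := h ⟨⟨Q, hQ⟩, hQp, hrel⟩ hgQ
  exact htx (hIQ (Ideal.mem_homogeneousCore_of_homogeneous_of_mem ht htI))

lemma exists_forall_pow_mem_of_mem_radical {ι : Type*} [Finite ι] {I : Ideal A} {g : ι → A}
    (h : ∀ i, g i ∈ I.radical) : ∃ N : ℕ, ∀ i, g i ^ N ∈ I := by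
  refine Filter.Eventually.exists (f := Filter.atTop) (Filter.eventually_all.2 fun i => ?_)
  obtain ⟨N₀, hN₀⟩ := h i
  filter_upwards [Filter.eventually_ge_atTop N₀] with N hN using Ideal.pow_mem_of_pow_mem _ hN₀ hN

end ProjectiveSpectrum

lemma mem_span_range_X_of_isHomogeneous {σ R : Type*} [CommSemiring R] {n : ℕ} (hn : 0 < n)
    {p : MvPolynomial σ R} (hp : p.IsHomogeneous n) : p ∈ Ideal.span (Set.range X) := by
  rw [← Set.image_univ, mem_ideal_span_X_image]
  intro m hm
  by_contra! h
  obtain rfl : m = 0 := Finsupp.ext fun j => h j trivial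
  exact mem_support_iff.1 hm (hp.coeff_eq_zero (by simpa using hn.ne))

lemma exists_X_mem_compl (x : ProjectiveSpectrum (gradP r)) : ∃ i, X i ∈ compl x := by
  by_contra! h
  have hle : Ideal.span (Set.range X) ≤ x.asHomogeneousIdeal.toIdeal := by
    rw [Ideal.span_le]
    rintro _ ⟨i, rfl⟩
    exact not_not.1 (h i)
  exact x.not_irrelevant_le ((HomogeneousIdeal.irrelevant_le _).2 fun _ hn _ hp =>
    hle (mem_span_range_X_of_isHomogeneous hn hp))

lemma exists_forall_X_pow_mem {I : Ideal (P r)} (h : ∀ x : ProjectiveSpectrum (gradP r),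
      ∃ t ∈ I, SetLike.IsHomogeneousElem (gradP r) t ∧ t ∈ compl x) :
    ∃ N : ℕ, ∀ j : Fin (r + 1), X j ^ N ∈ I :=
  exists_forall_pow_mem_of_mem_radical fun j =>
    mem_radical_of_forall_exists_homogeneous one_pos (isHomogeneous_X ℂ j) fun x _ => h x

lemma ne_zero_of_mem_compl {x : ProjectiveSpectrum (gradP r)} {p : P r} (h : p ∈ compl x) :
    p ≠ 0 := by
  rintro rfl
  exact h (Ideal.zero_mem _)

/-- The generic point of `ℙ^r`, which lies in every nonempty open set. -/
def genericPt (r : ℕ) : ProjectiveSpectrum (gradP r) where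
  asHomogeneousIdeal := ⊥
  isPrime := by simpa using Ideal.isPrime_bot
  not_irrelevant_le h := X_ne_zero (R := ℂ) (0 : Fin (r + 1))
    (h (HomogeneousIdeal.mem_irrelevant_of_mem _ one_pos (isHomogeneous_X ℂ 0)))

lemma genericPt_mem {U : Opens (ProjSpace r)} {x : ProjSpace r} (hx : x ∈ U) :
    (genericPt r : ProjSpace r) ∈ U := by
  obtain ⟨e, -, g, -, hgx, hgU⟩ := exists_basicOpen_le_of_mem hx
  exact hgU (show g ≠ 0 from ne_zero_of_mem_compl hgx)

/-! ### Homogeneous components indexed by the integers -/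

/-- The homogeneous component of degree `n ∈ ℤ` of a polynomial; it vanishes for `n < 0`. -/
def polyProj (r : ℕ) (n : ℤ) : P r →+ P r :=
  if 0 ≤ n then (homogeneousComponent n.toNat : P r →ₗ[ℂ] P r).toAddMonoidHom else 0

lemma polyProj_natCast (n : ℕ) (p : P r) : polyProj r n p = homogeneousComponent n p := by
  simp [polyProj]

lemma polyProj_of_neg {n : ℤ} (h : n < 0) (p : P r) : polyProj r n p = 0 := by
  simp [polyProj, not_le.2 h]

lemma polyProj_mem (n : ℤ) (p : P r) : polyProj r n p ∈ polyPiece r n := by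
  rcases lt_or_ge n 0 with h | h
  · rw [polyProj_of_neg h]
    exact AddSubgroup.zero_mem _
  · lift n to ℕ using h
    rw [polyProj_natCast]
    exact Or.inr ⟨n, rfl, homogeneousComponent_isHomogeneous n p⟩

lemma polyProj_of_mem {n : ℤ} {p : P r} (h : p ∈ polyPiece r n) : polyProj r n p = p := by
  rcases h with rfl | ⟨m, rfl, h⟩
  · exact map_zero _
  · rw [polyProj_natCast, homogeneousComponent_of_mem h, if_pos rfl]

lemma polyProj_of_mem_of_ne {m n : ℤ} {p : P r} (h : p ∈ polyPiece r m) (hmn : m ≠ n) :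
    polyProj r n p = 0 := by
  rcases h with rfl | ⟨m, rfl, h⟩
  · exact map_zero _
  · rcases lt_or_ge n 0 with hn | hn
    · exact polyProj_of_neg hn p
    · lift n to ℕ using hn
      rw [polyProj_natCast, homogeneousComponent_of_mem h, if_neg (by omega)]

lemma coe_decompose_gradP (n : ℕ) (p : P r) :
    (DirectSum.decompose (gradP r) p n : P r) = homogeneousComponent n p :=
  decomposition.decompose'_apply p n

lemma polyProj_mul {e : ℕ} {g : P r} (hg : g ∈ gradP r e) (n : ℤ) (p : P r) :
    polyProj r (n + e) (g * p) = g * polyProj r n p := by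
  rcases lt_or_ge (n + e) 0 with h | h
  · rw [polyProj_of_neg h, polyProj_of_neg (by omega), mul_zero]
  · obtain ⟨m, hm⟩ := Int.eq_ofNat_of_zero_le h
    rw [hm, polyProj_natCast, ← coe_decompose_gradP,
      DirectSum.coe_decompose_mul_of_left_mem (gradP r) m hg]
    split_ifs with hle
    · obtain rfl : n = ((m - e : ℕ) : ℤ) := by omega
      rw [polyProj_natCast, coe_decompose_gradP]
    · rw [polyProj_of_neg (by omega), mul_zero]

lemma mul_mem_polyPiece {e : ℕ} {g p : P r} (hg : g ∈ gradP r e) {n m : ℤ}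
    (hp : p ∈ polyPiece r n) (h : n + e = m) : g * p ∈ polyPiece r m :=
  h ▸ GradedPieces.smul_mem hg hp

lemma pow_mem_gradP {e : ℕ} {g : P r} (hg : g ∈ gradP r e) (N : ℕ) : g ^ N ∈ gradP r (N * e) := by
  simpa using SetLike.pow_mem_graded N hg

/-! ### A Čech criterion for the vanishing of the first cohomology group -/

section Cech

open TopCat.Presheaf

universe u

variable {X : TopCat.{u}}

lemma restrictOpen_sub {F : TopCat.Presheaf AddCommGrpCat.{u} X} {U V : Opens X} (h : V ≤ U)
    (s t : F.obj (op U)) :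
    restrictOpen (s - t) V h = restrictOpen s V h - restrictOpen t V h :=
  map_sub (F.map (homOfLE h).op).hom s t

variable {F G : CategoryTheory.Sheaf (Opens.grothendieckTopology X) AddCommGrpCat.{u}}
  {S T : ShortComplex (CategoryTheory.Sheaf (Opens.grothendieckTopology X) AddCommGrpCat.{u})}

lemma app_injective_of_mono (f : F ⟶ G) [Mono f]
    (U : Opens X) : Function.Injective (f.hom.app (op U)) := by
  have : Mono ((sheafToPresheaf _ _).map f) := inferInstance
  have : Mono (((evaluation _ _).obj (op U)).map ((sheafToPresheaf _ _).map f)) := inferInstance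
  exact (AddCommGrpCat.mono_iff_injective _).1 this

variable (F) in
/-- Every Čech `1`-cocycle of `F` for the cover `U` is a coboundary. The cocycle condition is
imposed on every open set contained in a triple intersection. -/
def CechOneVanishes {ι : Type u} (U : ι → Opens X) : Prop :=
  ∀ a : ∀ i j, F.obj.obj (op (U i ⊓ U j)),
    (∀ i j k, ∀ W : Opens X, ∀ (hi : W ≤ U i) (hj : W ≤ U j) (hk : W ≤ U k),
      restrictOpen (a j k) W (le_inf hj hk) - restrictOpen (a i k) W (le_inf hi hk) +
        restrictOpen (a i j) W (le_inf hi hj) = 0) →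
    ∃ c : ∀ i, F.obj.obj (op (U i)), ∀ i j,
      a i j = restrictOpen (c j) (U i ⊓ U j) inf_le_right -
        restrictOpen (c i) (U i ⊓ U j) inf_le_left

lemma app_g_app_f (U : Opens X) (s : S.X₁.obj.obj (op U)) :
    S.g.hom.app (op U) (S.f.hom.app (op U) s) = 0 := by
  rw [← CategoryTheory.comp_apply, ← NatTrans.comp_app,
    ← ObjectProperty.FullSubcategory.comp_hom, S.zero]
  rfl

lemma exists_compatible_lifts_of_cechOneVanishes (hS : S.ShortExact) {ι : Type u}
    {U : ι → Opens X} (hU : CechOneVanishes S.X₁ U) {q : S.X₃.obj.obj (op ⊤)}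
    (hq : ∀ i, ∃ u, S.g.hom.app (op (U i)) u = restrictOpen q (U i) le_top) :
    ∃ u : ∀ i, S.X₂.obj.obj (op (U i)), IsCompatible S.X₂.obj U u ∧
      ∀ i, S.g.hom.app (op (U i)) (u i) = restrictOpen q (U i) le_top := by
  have hmono := hS.mono_f
  choose u hu using hq
  have hdiff : ∀ i j, ∃ a, S.f.hom.app (op (U i ⊓ U j)) a =
      restrictOpen (u j) (U i ⊓ U j) inf_le_right -
        restrictOpen (u i) (U i ⊓ U j) inf_le_left := fun i j => by
    refine TopCat.Sheaf.sections_exact_of_left_exact hS.1 hS.2 _ ?_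
    rw [map_sub, map_restrict, map_restrict, hu, hu, restrict_restrict, restrict_restrict, sub_self]
  choose a ha using hdiff
  obtain ⟨c, hc⟩ := hU a fun i j k W hi hj hk => by
    apply app_injective_of_mono S.f W
    rw [map_add, map_sub, map_restrict, map_restrict, map_restrict, ha, ha, ha, map_zero]
    simp only [restrictOpen_sub, restrict_restrict]
    abel
  refine ⟨fun i => u i - S.f.hom.app (op (U i)) (c i), fun i j => ?_, fun i => ?_⟩
  · change restrictOpen _ (U i ⊓ U j) inf_le_left = restrictOpen _ (U i ⊓ U j) inf_le_right
    have h := ha i j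
    rw [hc i j, map_sub, map_restrict, map_restrict, sub_eq_sub_iff_add_eq_add] at h
    rw [restrictOpen_sub, restrictOpen_sub, sub_eq_sub_iff_add_eq_add,
      add_comm _ (restrictOpen (S.f.hom.app _ (c j)) _ _), h, add_comm]
  · rw [map_sub, app_g_app_f, sub_zero, hu]

lemma exists_app_eq_of_cechOneVanishes (hS : S.ShortExact) {ι : Type u} {U : ι → Opens X}
    (hcov : iSup U = ⊤) (hU : CechOneVanishes S.X₁ U) {q : S.X₃.obj.obj (op ⊤)}
    (hq : ∀ i, ∃ u, S.g.hom.app (op (U i)) u = restrictOpen q (U i) le_top) :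
    ∃ t, S.g.hom.app (op ⊤) t = q := by
  obtain ⟨u, hcompat, hu⟩ := exists_compatible_lifts_of_cechOneVanishes hS hU hq
  obtain ⟨s, hs, -⟩ := TopCat.Sheaf.existsUnique_gluing S.X₂ U u hcompat
  have hgs : S.g.hom.app (op (iSup U)) s = restrictOpen q (iSup U) le_top :=
    TopCat.Sheaf.eq_app_of_locally_eq hs (fun _ => le_top) hu
  refine ⟨restrictOpen s ⊤ hcov.ge, ?_⟩
  rw [map_restrict, hgs, restrict_restrict]
  exact ConcreteCategory.congr_hom (S.X₃.obj.map_id _) q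

/-- The connecting homomorphism `H⁰(X₃) → H¹(X₁)` of a short exact sequence of sheaves. -/
def connectingHom (hS : S.ShortExact) : S.X₃.obj.obj (op ⊤) →+ Sheaf.H S.X₁ 1 :=
  (hS.extClass.postcomp _ (zero_add 1)).comp
    (Sheaf.H.equiv₀ S.X₃ Limits.isTerminalTop).symm.toAddMonoidHom

lemma map_connectingHom (hS : S.ShortExact) (hT : T.ShortExact) (φ : S ⟶ T)
    (s : S.X₃.obj.obj (op ⊤)) :
    Sheaf.H.map φ.τ₁ 1 (connectingHom hS s) = connectingHom hT (φ.τ₃.hom.app (op ⊤) s) := by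
  change (Abelian.Ext.comp _ hS.extClass (zero_add 1)).comp (Abelian.Ext.mk₀ φ.τ₁) (add_zero 1) =
    Abelian.Ext.comp _ hT.extClass (zero_add 1)
  rw [Abelian.Ext.comp_assoc_of_third_deg_zero, ShortComplex.ShortExact.extClass_naturality hS hT φ,
    ← Abelian.Ext.comp_assoc_of_second_deg_zero]
  exact congrArg (fun q => Abelian.Ext.comp q hT.extClass (zero_add 1))
    (Sheaf.H.equiv₀_symm_naturality Limits.isTerminalTop φ.τ₃ s)

lemma connectingHom_eq_zero_iff (hS : S.ShortExact) {s : S.X₃.obj.obj (op ⊤)} :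
    connectingHom hS s = 0 ↔ ∃ t, S.g.hom.app (op ⊤) t = s := by
  constructor
  · intro h
    obtain ⟨q, hq⟩ := Abelian.Ext.covariant_sequence_exact₃ _ hS _ (zero_add 1) h
    exact ⟨Sheaf.H.equiv₀ S.X₂ Limits.isTerminalTop q,
      (Sheaf.H.equiv₀_naturality Limits.isTerminalTop S.g q).trans
        ((AddEquiv.eq_symm_apply _).1 hq)⟩
  · rintro ⟨t, rfl⟩
    change Abelian.Ext.comp ((Sheaf.H.equiv₀ S.X₃ Limits.isTerminalTop).symm _) _ (zero_add 1) = 0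
    rw [← Sheaf.H.equiv₀_symm_naturality, Sheaf.H.map_apply,
      Abelian.Ext.comp_assoc_of_second_deg_zero, hS.comp_extClass, Abelian.Ext.comp_zero]

lemma connectingHom_surjective (hS : S.ShortExact) [Subsingleton (Sheaf.H S.X₂ 1)] :
    Function.Surjective (connectingHom hS) := fun x => by
  obtain ⟨q, rfl⟩ := Abelian.Ext.covariant_sequence_exact₁ _ hS x
    (Subsingleton.elim (α := Sheaf.H S.X₂ 1) _ _) (zero_add 1)
  exact ⟨Sheaf.H.equiv₀ S.X₃ Limits.isTerminalTop q,
    congrArg (fun q => Abelian.Ext.comp q hS.extClass (zero_add 1))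
      (AddEquiv.symm_apply_apply _ q)⟩

lemma bijective_map_of_isIso (φ : F ⟶ G) [IsIso φ] (n : ℕ) :
    Function.Bijective (Sheaf.H.map φ n) :=
  Function.bijective_iff_has_inverse.2 ⟨Sheaf.H.map (inv φ) n,
    fun x => by rw [← Sheaf.H.map_comp_apply, IsIso.hom_inv_id, Sheaf.H.map_id_apply],
    fun x => by rw [← Sheaf.H.map_comp_apply, IsIso.inv_hom_id, Sheaf.H.map_id_apply]⟩

lemma subsingleton_H_one_of_cechOneVanishes
    (hF : ∀ V : X → Opens X, (∀ x, x ∈ V x) → ∃ (ι : Type u) (p : ι → X) (U : ι → Opens X),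
      (∀ i, U i ≤ V (p i)) ∧ iSup U = ⊤ ∧ CechOneVanishes F U) :
    Subsingleton (Sheaf.H F 1) := by
  let S := ShortComplex.mk (Injective.ι F) (Limits.cokernel.π (Injective.ι F))
    (Limits.cokernel.condition _)
  have hS : S.ShortExact :=
    { exact := ShortComplex.exact_cokernel _
      mono_f := inferInstanceAs (Mono (Injective.ι F))
      epi_g := inferInstanceAs (Epi (Limits.cokernel.π _)) }
  have hlift : ∀ q : S.X₃.obj.obj (op ⊤), ∃ t, S.g.hom.app (op ⊤) t = q := fun q => by
    have hloc := (isLocallySurjective_iff S.g.hom).1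
      ((TopCat.Sheaf.isLocallySurjective_iff_epi S.g).2 hS.epi_g) ⊤ q
    choose V hV ht hx using fun x => hloc x trivial
    choose t ht using ht
    obtain ⟨ι, p, U, hUV, hcov, hU⟩ := hF V hx
    refine exists_app_eq_of_cechOneVanishes hS hcov hU fun i =>
      ⟨restrictOpen (t (p i)) (U i) (hUV i), ?_⟩
    rw [map_restrict, ht, restrict_restrict]
  have : Subsingleton (Sheaf.H S.X₂ 1) := subsingleton_of_forall_eq 0 fun x =>
    Abelian.Ext.eq_zero_of_injective (I := Injective.under F) (n := 0) x
  refine subsingleton_of_forall_eq 0 fun x => ?_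
  obtain ⟨q, rfl⟩ := connectingHom_surjective hS x
  exact (connectingHom_eq_zero_iff hS).2 (hlift q)

end Cech

/-! ### Sections of the sheaves `𝒪(k)` -/

section LocalizedModule

variable {R M : Type*} [CommRing R] [AddCommGroup M] [Module R M] {S : Submonoid R}

lemma mk_one_eq_smul_mk {m : M} {s : S} :
    (s : R) • LocalizedModule.mk m s = LocalizedModule.mk m 1 := by
  rw [LocalizedModule.smul'_mk]
  exact LocalizedModule.mk_cancel s m

lemma smul_localizedModule_injective {s : R} (hs : s ∈ S) :
    Function.Injective fun z : LocalizedModule S M => s • z :=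
  IsLocalizedModule.smul_injective (LocalizedModule.mkLinearMap S M) ⟨s, hs⟩

lemma mk_eq_mk_iff_mul_eq (hS : S ≤ nonZeroDivisors R) {m m' : R} {s s' : S} :
    (LocalizedModule.mk m s : LocalizedModule S R) = LocalizedModule.mk m' s' ↔
      s' * m = s * m' := by
  rw [LocalizedModule.mk_eq]
  exact ⟨fun ⟨u, hu⟩ => mul_cancel_left_mem_nonZeroDivisors (hS u.2) |>.1 hu,
    fun h => ⟨1, congrArg _ h⟩⟩

lemma smul_eq_mk_one_iff_mul_eq [IsDomain R] (hS : S ≤ nonZeroDivisors R) {s t m p : R}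
    (hs : s ≠ 0) {z : LocalizedModule S R} (hz : s • z = LocalizedModule.mk m 1) :
    t • z = LocalizedModule.mk p 1 ↔ t * m = s * p := by
  induction z using LocalizedModule.induction_on with
  | h a b =>
    have hb : (b : R) ≠ 0 := nonZeroDivisors.ne_zero (hS b.2)
    rw [LocalizedModule.smul'_mk, mk_eq_mk_iff_mul_eq hS] at hz ⊢
    simp only [OneMemClass.coe_one, one_mul, smul_eq_mul] at hz ⊢
    constructor <;> intro h
    · exact mul_left_cancel₀ hb (by linear_combination s * h - t * hz)
    · exact mul_left_cancel₀ hs (by linear_combination b * h + t * hz)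

end LocalizedModule

lemma compl_le_nonZeroDivisors (x : ProjectiveSpectrum (gradP r)) :
    compl x ≤ nonZeroDivisors (P r) :=
  fun _ h => mem_nonZeroDivisors_of_ne_zero (ne_zero_of_mem_compl h)

section Fractions

variable {M : Type} [AddCommGroup M] [Module (P r) M] {𝓜 : ℤ → AddSubgroup M} [GradedPieces r 𝓜]
  {k : ℤ} {U : Opens (ProjSpace r)} {e : ℕ} {t : P r} {m : M}

/-- The section `m / t` of `M(k)^~` over an open set on which `t` has no zeros. -/
def fracSection (ht : t ∈ gradP r e) (hm : m ∈ 𝓜 (k + e)) (hU : ∀ x : U, t ∈ compl x.1) :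
    sections 𝓜 k U :=
  ⟨fun x => LocalizedModule.mk m ⟨t, hU x⟩,
    fun x => ⟨U, x.2, 𝟙 U, e, m, t, hm, ht, hU, fun _ => rfl⟩⟩

lemma smul_fracSection (ht : t ∈ gradP r e) (hm : m ∈ 𝓜 (k + e)) (hU : ∀ x : U, t ∈ compl x.1)
    (x : U) : t • (fracSection ht hm hU).1 x = LocalizedModule.mk m 1 :=
  mk_one_eq_smul_mk (s := ⟨t, hU x⟩)

end Fractions

section StructureSheaf

variable {k : ℤ} {U : Opens (ProjSpace r)}

lemma exists_forall_smul_section_eq (f : sections (polyPiece r) k U) (x : U) :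
    ∃ i : ℕ, ∃ m ∈ polyPiece r (k + i), ∃ s ∈ gradP r i, s ∈ compl x.1 ∧
      ∀ y : U, s • f.1 y = LocalizedModule.mk m 1 := by
  obtain ⟨V, hxV, _, i, m, s, hm, hs, hsV, hf⟩ := f.2 x
  refine ⟨i, m, hm, s, hs, hsV ⟨x.1, hxV⟩, fun y => ?_⟩
  obtain ⟨W, hyW, _, j, n, t, -, -, htW, hf'⟩ := f.2 y
  -- the two local expressions are compared at the generic point
  have heq := (hf ⟨genericPt r, genericPt_mem hxV⟩).symm.trans (hf' ⟨_, genericPt_mem hyW⟩)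
  rw [mk_eq_mk_iff_mul_eq (compl_le_nonZeroDivisors _)] at heq
  refine (congrArg (s • ·) (hf' ⟨y.1, hyW⟩)).trans <| (LocalizedModule.smul'_mk ..).trans <|
    (mk_eq_mk_iff_mul_eq (compl_le_nonZeroDivisors _)).2 ?_
  rw [OneMemClass.coe_one, one_mul]
  exact heq.symm

lemma smul_section_eq_mk_iff (f : sections (polyPiece r) k U) (x y : U) {t p : P r} :
    t • f.1 x = LocalizedModule.mk p 1 ↔ t • f.1 y = LocalizedModule.mk p 1 := by
  obtain ⟨i, m, -, s, -, hsx, hs⟩ := exists_forall_smul_section_eq f x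
  have hs0 := ne_zero_of_mem_compl hsx
  rw [smul_eq_mk_one_iff_mul_eq (compl_le_nonZeroDivisors _) hs0 (hs x),
    smul_eq_mk_one_iff_mul_eq (compl_le_nonZeroDivisors _) hs0 (hs y)]

lemma eventually_exists_pow_smul_section_eq (f : sections (polyPiece r) k U) {e : ℕ} (he : 0 < e)
    {g : P r} (hg : g ∈ gradP r e) (hU : ProjectiveSpectrum.basicOpen (gradP r) g ≤ U) :
    ∀ᶠ N : ℕ in Filter.atTop, ∃ p ∈ polyPiece r (k + (N * e : ℕ)),
      ∀ x : U, g ^ N • f.1 x = LocalizedModule.mk p 1 := by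
  let I : Ideal (P r) :=
    { carrier := {t | ∃ p, ∀ x : U, t • f.1 x = LocalizedModule.mk p 1}
      zero_mem' := ⟨0, fun x => by rw [zero_smul, LocalizedModule.zero_mk]⟩
      add_mem' := by
        rintro t t' ⟨p, hp⟩ ⟨p', hp'⟩
        refine ⟨p + p', fun x => ?_⟩
        rw [add_smul, hp, hp', LocalizedModule.mk_add_mk, one_smul, one_smul, one_mul]
      smul_mem' := by
        rintro c t ⟨p, hp⟩
        refine ⟨c • p, fun x => ?_⟩
        rw [smul_eq_mul, mul_smul, hp, LocalizedModule.smul'_mk] }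
  obtain ⟨N₀, hN₀⟩ : g ∈ I.radical :=
    mem_radical_of_forall_exists_homogeneous he hg fun x hx => by
      obtain ⟨i, m, -, s, hs, hsx, hsf⟩ := exists_forall_smul_section_eq f ⟨x, hU hx⟩
      exact ⟨s, ⟨m, hsf⟩, ⟨i, hs⟩, hsx⟩
  filter_upwards [Filter.eventually_ge_atTop N₀] with N hN
  obtain ⟨p, hp⟩ := I.pow_mem_of_pow_mem hN₀ hN
  refine ⟨polyProj r (k + (N * e : ℕ)) p, polyProj_mem _ _, fun x => ?_⟩
  obtain ⟨i, m, hm, s, hs, hsx, hsf⟩ := exists_forall_smul_section_eq f x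
  have hs0 := ne_zero_of_mem_compl hsx
  rw [smul_eq_mk_one_iff_mul_eq (compl_le_nonZeroDivisors _) hs0 (hsf x), ← polyProj_mul hs,
    ← (smul_eq_mk_one_iff_mul_eq (compl_le_nonZeroDivisors _) hs0 (hsf x)).1 (hp x),
    polyProj_of_mem (mul_mem_polyPiece (pow_mem_gradP hg N) hm (by ring))]

lemma exists_forall_section_eq_mk (hr : 1 ≤ r) (f : sections (polyPiece r) k ⊤) :
    ∃ a ∈ polyPiece r k, ∀ x : (⊤ : Opens (ProjSpace r)), f.1 x = LocalizedModule.mk a 1 := by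
  let η : (⊤ : Opens (ProjSpace r)) := ⟨genericPt r, trivial⟩
  have hX : ∀ i, ∃ N : ℕ, ∃ p ∈ polyPiece r (k + N),
      (X i : P r) ^ N • f.1 η = LocalizedModule.mk p 1 := fun i => by
    obtain ⟨N, p, hp, hfp⟩ :=
      (eventually_exists_pow_smul_section_eq f one_pos (isHomogeneous_X ℂ i) le_top).exists
    exact ⟨N, p, by simpa using hp, hfp η⟩
  obtain ⟨N, p, hp, hfp⟩ := hX 0
  obtain ⟨M, q, -, hfq⟩ := hX (Fin.last r)
  have hX0 : (X 0 : P r) ^ N ≠ 0 := pow_ne_zero _ (X_ne_zero _)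
  obtain ⟨a, rfl⟩ : (X 0 : P r) ^ N ∣ p := by
    refine (X_prime (R := ℂ) (i := (0 : Fin (r + 1)))).pow_dvd_of_dvd_mul_left N
      (fun h => ?_) ⟨q, (smul_eq_mk_one_iff_mul_eq (compl_le_nonZeroDivisors _) hX0 hfp).1 hfq⟩
    have := congrArg Fin.val (X_dvd_X.1 (X_prime.dvd_of_dvd_pow h))
    rw [Fin.val_zero, Fin.val_last] at this
    omega
  refine ⟨polyProj r k a, polyProj_mem _ _, fun x => ?_⟩
  rw [← one_smul (P r) (f.1 x), smul_section_eq_mk_iff f x η,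
    smul_eq_mk_one_iff_mul_eq (compl_le_nonZeroDivisors _) hX0 hfp, one_mul,
    ← polyProj_mul (e := N) (by simpa using pow_mem_gradP (isHomogeneous_X ℂ 0) N),
    polyProj_of_mem hp]

end StructureSheaf

/-! ### Vanishing of `H¹(𝒪(k))` -/

lemma exists_finset_forall_exists_notMem {A σ : Type*} [CommRing A] [IsNoetherianRing A]
    [SetLike σ A] [AddSubgroupClass σ A] {𝒜 : ℕ → σ} [GradedRing 𝒜] {ι : Type*} {g : ι → A}
    (hcov : ∀ x : ProjectiveSpectrum 𝒜, ∃ i, g i ∉ x.asHomogeneousIdeal) :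
    ∃ T : Finset ι, ∀ x : ProjectiveSpectrum 𝒜, ∃ i ∈ T, g i ∉ x.asHomogeneousIdeal := by
  classical
  obtain ⟨s, hs, hspan⟩ := Submodule.fg_span_iff_fg_span_finset_subset (R := A) (Set.range g) |>.1
    (IsNoetherian.noetherian _)
  obtain ⟨T, -, rfl⟩ := Finset.subset_set_image_iff.1 (hs.trans_eq Set.image_univ.symm)
  refine ⟨T, fun x => ?_⟩
  by_contra! h
  obtain ⟨i, hi⟩ := hcov x
  have hle : Submodule.span A (Set.range g) ≤ x.asHomogeneousIdeal.toIdeal := by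
    rw [hspan, Submodule.span_le, Finset.coe_image]
    rintro _ ⟨j, hj, rfl⟩
    exact h j hj
  exact hi (hle (Submodule.subset_span ⟨i, rfl⟩))

lemma exists_homogeneous_koszul_primitive (hr : 2 ≤ r) {ι : Type*} [Finite ι] {g : ι → P r}
    {e : ι → ℕ} (hg : ∀ i, g i ∈ gradP r (e i))
    (hcov : ∀ x : ProjectiveSpectrum (gradP r), ∃ i, g i ∈ compl x) {n : ℤ} {b : ι → ι → P r}
    (hbn : ∀ i j, b i j ∈ polyPiece r (n + e i + e j))
    (hb : ∀ i j k, g i * b j k - g j * b i k + g k * b i j = 0) :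
    ∃ c : ι → P r, (∀ i, c i ∈ polyPiece r (n + e i)) ∧
      ∀ i j, b i j = g j * c i - g i * c j := by
  obtain ⟨N, hN⟩ := exists_forall_X_pow_mem (I := Ideal.span (Set.range g)) fun x =>
    (hcov x).imp' g fun i hi => ⟨Ideal.subset_span ⟨i, rfl⟩, ⟨e i, hg i⟩, hi⟩
  let v : Fin 3 → Fin (r + 1) := Fin.castLE (by omega)
  have hv : ([v 0, v 1, v 2] : List (Fin (r + 1))).Nodup :=
    (List.nodup_map_iff (l := [0, 1, 2]) (Fin.castLE_injective _)).2 (by decide)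
  obtain ⟨c, hc⟩ := exists_koszul_primitive_of_isWeaklyRegular (hN _) (hN _) (hN _)
    (isWeaklyRegular_X_pow (R := ℂ) hv N) hb
  refine ⟨fun i => polyProj r (n + e i) (c i), fun i => polyProj_mem _ _, fun i j => ?_⟩
  rw [← polyProj_of_mem (hbn i j), hc, map_sub, smul_eq_mul, smul_eq_mul, polyProj_mul (hg j),
    add_right_comm, polyProj_mul (hg i)]

lemma koszul_relation_of_germ_cocycle {ι : Type*} {U : ι → Opens (ProjSpace r)}
    (hU : ∀ i, (genericPt r : ProjSpace r) ∈ U i) {k : ℤ}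
    {a : ∀ i j, sections (polyPiece r) k (U i ⊓ U j)}
    (ha : ∀ i j l, ∀ x : (U i ⊓ U j ⊓ U l : Opens (ProjSpace r)),
      (a j l).1 ⟨x.1, x.2.1.2, x.2.2⟩ - (a i l).1 ⟨x.1, x.2.1.1, x.2.2⟩ +
        (a i j).1 ⟨x.1, x.2.1⟩ = 0)
    {G : ι → P r} {b : ι → ι → P r}
    (hb : ∀ i j x, (G i * G j) • (a i j).1 x = LocalizedModule.mk (b i j) 1) (i j l : ι) :
    G i * b j l - G j * b i l + G l * b i j = 0 := by
  have hgerm := ha i j l ⟨genericPt r, ⟨hU i, hU j⟩, hU l⟩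
  have hmk : LocalizedModule.mkLinearMap (compl (genericPt r)) (P r)
      (G i * b j l - G j * b i l + G l * b i j) = 0 := by
    simp only [← smul_eq_mul, map_add, map_sub, map_smul, LocalizedModule.mkLinearMap_apply,
      ← hb _ _ ⟨genericPt r, hU _, hU _⟩]
    linear_combination (norm := module) (G i * G j * G l) • hgerm
  simpa only [LocalizedModule.mkLinearMap_apply, ← LocalizedModule.zero_mk 1,
    mk_eq_mk_iff_mul_eq (compl_le_nonZeroDivisors _), OneMemClass.coe_one, one_mul] using hmk

section BasicOpenCover

variable {ι : Type} [Finite ι] {g : ι → P r} {e : ι → ℕ}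

open ProjectiveSpectrum (basicOpen)

lemma exists_common_numerators (he : ∀ i, 0 < e i) (hg : ∀ i, g i ∈ gradP r (e i)) {k : ℤ}
    (a : ∀ i j, sections (polyPiece r) k (basicOpen (gradP r) (g i) ⊓ basicOpen (gradP r) (g j))) :
    ∃ N : ℕ, ∃ b : ι → ι → P r,
      (∀ i j, b i j ∈ polyPiece r (k + (N * e i : ℕ) + (N * e j : ℕ))) ∧
      ∀ i j x, (g i ^ N * g j ^ N) • (a i j).1 x = LocalizedModule.mk (b i j) 1 := by
  have h : ∀ i j, ∀ᶠ N : ℕ in Filter.atTop,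
      ∃ p ∈ polyPiece r (k + (N * e i : ℕ) + (N * e j : ℕ)),
        ∀ x, (g i ^ N * g j ^ N) • (a i j).1 x = LocalizedModule.mk p 1 := fun i j => by
    filter_upwards [eventually_exists_pow_smul_section_eq (a i j) (Nat.add_pos_left (he i) _)
      (SetLike.mul_mem_graded (hg i) (hg j)) (ProjectiveSpectrum.basicOpen_mul _ _ _).le]
      with N hN
    simpa only [mul_pow, mul_add, Nat.cast_add, add_assoc] using hN
  obtain ⟨N, hN⟩ := (Filter.eventually_all.2 fun i => Filter.eventually_all.2 (h i)).exists
  choose b hbk hb using hN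
  exact ⟨N, b, hbk, hb⟩

lemma cechOneVanishes_basicOpen (hr : 2 ≤ r) (he : ∀ i, 0 < e i)
    (hg : ∀ i, g i ∈ gradP r (e i)) (hg0 : ∀ i, g i ≠ 0)
    (hcov : ∀ x : ProjectiveSpectrum (gradP r), ∃ i, g i ∈ compl x) (k : ℤ) :
    CechOneVanishes (X := ProjSpace r) (assoc (polyPiece r) k)
      fun i => basicOpen (gradP r) (g i) := by
  intro (a : ∀ i j, sections (polyPiece r) k
    (basicOpen (gradP r) (g i) ⊓ basicOpen (gradP r) (g j))) ha
  obtain ⟨N, b, hbk, hb⟩ := exists_common_numerators he hg a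
  have hcoc := koszul_relation_of_germ_cocycle (a := a) hg0 (fun i j l => congrFun <|
    congrArg Subtype.val (ha i j l _ (inf_le_left.trans inf_le_left)
      (inf_le_left.trans inf_le_right) inf_le_right)) hb
  obtain ⟨c, hck, hc⟩ := exists_homogeneous_koszul_primitive hr (fun i => pow_mem_gradP (hg i) N)
    (fun x => (hcov x).imp fun i hi => Submonoid.pow_mem _ hi N) hbk hcoc
  let U : ι → Opens (ProjSpace r) := fun i => basicOpen (gradP r) (g i)
  have hU : ∀ i, ∀ x : U i, g i ^ N ∈ compl x.1 := fun i x => Submonoid.pow_mem _ x.2 N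
  let s : ∀ i, sections (polyPiece r) k (U i) := fun i =>
    fracSection (pow_mem_gradP (hg i) N) (neg_mem (hck i)) (hU i)
  refine ⟨s, fun i j => Subtype.ext (funext fun x => ?_)⟩
  have hi : g i ^ N • (s i).1 ⟨x.1, x.2.1⟩ = LocalizedModule.mk (-c i) 1 := smul_fracSection ..
  have hj : g j ^ N • (s j).1 ⟨x.1, x.2.2⟩ = LocalizedModule.mk (-c j) 1 := smul_fracSection ..
  refine smul_localizedModule_injective (mul_mem (hU i ⟨x.1, x.2.1⟩) (hU j ⟨x.1, x.2.2⟩))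
    ((hb i j x).trans ?_)
  change _ = (g i ^ N * g j ^ N) • ((s j).1 ⟨x.1, x.2.2⟩ - (s i).1 ⟨x.1, x.2.1⟩)
  rw [smul_sub, mul_smul, hj, mul_comm, mul_smul, hi, hc]
  simp only [← LocalizedModule.mkLinearMap_apply, ← map_smul, ← map_sub, smul_eq_mul]
  congr 1
  ring

end BasicOpenCover

lemma subsingleton_H_one_structureSheaf (hr : 2 ≤ r) (k : ℤ) :
    Subsingleton (Sheaf.H (assoc (polyPiece r) k : AbSheaf r) 1) := by
  refine subsingleton_H_one_of_cechOneVanishes fun V hV => ?_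
  choose e he g hg hgx hgV using fun x => exists_basicOpen_le_of_mem (hV x)
  obtain ⟨T, hT⟩ := exists_finset_forall_exists_notMem fun x => ⟨x, hgx x⟩
  have hcov : ∀ x : ProjectiveSpectrum (gradP r), ∃ t : T, g t.1 ∈ compl x := fun x => by
    obtain ⟨t, ht, hx⟩ := hT x
    exact ⟨⟨t, ht⟩, hx⟩
  refine ⟨T, Subtype.val, fun t => ProjectiveSpectrum.basicOpen (gradP r) (g t.1),
    fun t => hgV t.1, top_le_iff.1 fun x _ => Opens.mem_iSup.2 (hcov x), ?_⟩
  exact cechOneVanishes_basicOpen hr (fun t : T => he t.1) (fun t => hg t.1)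
    (fun t => ne_zero_of_mem_compl (hgx t.1)) hcov k

/-! ### Vector fields on affine space -/

lemma subsingleton_H_of_sum_comp_eq_id {ι : Type*} [Fintype ι] {F : AbSheaf r}
    {G : ι → AbSheaf r} (p : ∀ i, F ⟶ G i) (q : ∀ i, G i ⟶ F) (hpq : ∑ i, p i ≫ q i = 𝟙 F) (n : ℕ)
    [∀ i, Subsingleton (Sheaf.H (G i) n)] : Subsingleton (Sheaf.H F n) := by
  refine subsingleton_of_forall_eq 0 fun x => ?_
  calc x = Sheaf.H.map (∑ i, p i ≫ q i) n x := by rw [hpq, Sheaf.H.map_id_apply]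
    _ = ∑ i, Sheaf.H.map (q i) n (Sheaf.H.map (p i) n x) := by
        rw [Sheaf.H.map_apply, Abelian.Ext.mk₀_sum, Abelian.Ext.comp_sum]
        exact Finset.sum_congr rfl fun i _ => Sheaf.H.map_comp_apply ..
    _ = 0 := Finset.sum_eq_zero fun i _ => by
        rw [Subsingleton.elim (Sheaf.H.map (p i) n x) 0, map_zero]

section LocalizedMap

variable {R M N L : Type*} [CommRing R] [AddCommGroup M] [Module R M] [AddCommGroup N] [Module R N]
  [AddCommGroup L] [Module R L] {S : Submonoid R}

lemma localizedMap_comp (ψ : N →ₗ[R] L) (φ : M →ₗ[R] N)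
    (z : LocalizedModule S M) :
    LocalizedModule.map S ψ (LocalizedModule.map S φ z) = LocalizedModule.map S (ψ ∘ₗ φ) z := by
  induction z using LocalizedModule.induction_on with
  | h m s => simp only [LocalizedModule.map_mk, LinearMap.comp_apply]

lemma localizedMk_eq_zero_iff {m : M} {s : S} :
    (LocalizedModule.mk m s : LocalizedModule S M) = 0 ↔ ∃ u ∈ S, u • m = 0 := by
  rw [← LocalizedModule.zero_mk 1, LocalizedModule.mk_eq]
  simp only [smul_zero, one_smul, Submonoid.smul_def, Subtype.exists, exists_prop]

end LocalizedMap

section AssocMap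

variable {M N L : Type} [AddCommGroup M] [Module (P r) M] [AddCommGroup N] [Module (P r) N]
  [AddCommGroup L] [Module (P r) L] {𝓜 : ℤ → AddSubgroup M} [GradedPieces r 𝓜]
  {𝓝 : ℤ → AddSubgroup N} [GradedPieces r 𝓝] {𝓛 : ℤ → AddSubgroup L} [GradedPieces r 𝓛]

lemma assocMap_ext {φ φ' : M →ₗ[P r] N} {k l : ℤ} (hφ) (hφ') (h : φ = φ') :
    (assocMap φ k l hφ : (assoc 𝓜 k : AbSheaf r) ⟶ assoc 𝓝 l) = assocMap φ' k l hφ' := by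
  subst h; rfl

lemma assocMap_comp {φ : M →ₗ[P r] N} {ψ : N →ₗ[P r] L} {k l m : ℤ} (hφ) (hψ) :
    (assocMap φ k l hφ : (assoc 𝓜 k : AbSheaf r) ⟶ assoc 𝓝 l) ≫
        (assocMap ψ l m hψ : _ ⟶ assoc 𝓛 m) =
      assocMap (ψ ∘ₗ φ) k m fun i a ha => hψ i _ (hφ i a ha) := by
  ext U t
  exact Subtype.ext (funext fun x => localizedMap_comp ψ φ (t.1 x))

lemma assocMap_sum {ι : Type*} (s : Finset ι) {φ : ι → M →ₗ[P r] N} {k l : ℤ}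
    (hφ : ∀ i j, ∀ m ∈ 𝓜 (k + j), φ i m ∈ 𝓝 (l + j)) :
    ∑ i ∈ s, (assocMap (φ i) k l (hφ i) : (assoc 𝓜 k : AbSheaf r) ⟶ assoc 𝓝 l) =
      assocMap (∑ i ∈ s, φ i) k l fun j m hm => by
        rw [LinearMap.sum_apply]
        exact AddSubgroup.sum_mem _ fun i _ => hφ i j m hm := by
  classical
  induction s using Finset.induction_on with
  | empty =>
    ext U t
    exact Subtype.ext (funext fun x => (LinearMap.congr_fun
      (map_zero (LocalizedModule.map (compl x.1))) (t.1 x)).symm)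
  | insert i s hi ih =>
    rw [Finset.sum_insert hi, ih]
    ext U t
    refine Subtype.ext (funext fun x => ?_)
    change (LocalizedModule.map (compl x.1) (φ i) +
      LocalizedModule.map (compl x.1) (∑ j ∈ s, φ j)) (t.1 x) =
      LocalizedModule.map (compl x.1) (∑ j ∈ insert i s, φ j) (t.1 x)
    rw [Finset.sum_insert hi, map_add]

lemma assocMap_id {k : ℤ} :
    (assocMap LinearMap.id k k fun _ _ hm => hm : (assoc 𝓜 k : AbSheaf r) ⟶ assoc 𝓜 k) = 𝟙 _ := by
  ext U t
  refine Subtype.ext (funext fun x => ?_)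
  change LocalizedModule.map (compl x.1) LinearMap.id (t.1 x) = t.1 x
  induction t.1 x using LocalizedModule.induction_on with
  | h m s => rw [LocalizedModule.map_mk, LinearMap.id_apply]

lemma epi_assocMap {φ : M →ₗ[P r] N} {k l : ℤ} (hφ)
    (h : ∀ i : ℕ, ∀ n ∈ 𝓝 (l + i), ∃ m ∈ 𝓜 (k + i), φ m = n) :
    Epi (assocMap φ k l hφ : (assoc 𝓜 k : AbSheaf r) ⟶ assoc 𝓝 l) := by
  refine (TopCat.Sheaf.isLocallySurjective_iff_epi _).1 ?_
  refine (TopCat.Presheaf.isLocallySurjective_iff _).2 fun U t x hx => ?_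
  obtain ⟨V, hxV, ι, i, _, s, hn, hs, hsV, ht⟩ := t.2 ⟨x, hx⟩
  obtain ⟨m, hm, rfl⟩ := h i _ hn
  refine ⟨V, ι.le, ⟨fracSection hs hm hsV, Subtype.ext (funext fun y => ?_)⟩, hxV⟩
  exact (LocalizedModule.map_mk _ φ m _).trans (ht y).symm

end AssocMap

/-- The sheaf `𝒪(1)^{r+1}(k)` of vector fields on affine space. -/
abbrev fieldSheaf (r : ℕ) (k : ℤ) : AbSheaf r := assoc (fieldPiece r) k

/-- The coefficient of `∂/∂Xᵢ`, as a map `𝒪(1)^{r+1}(k) ⟶ 𝒪(k + 1)`. -/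
def fieldCoeff (k : ℤ) (i : Fin (r + 1)) :
    fieldSheaf r k ⟶ (assoc (polyPiece r) (k + 1) : AbSheaf r) :=
  assocMap (LinearMap.proj i) k (k + 1) fun j _ hm => add_right_comm k j 1 ▸ hm i

/-- The map `𝒪(k + 1) ⟶ 𝒪(1)^{r+1}(k)` sending `A` to `A ∂/∂Xᵢ`. -/
def fieldSingle (k : ℤ) (i : Fin (r + 1)) :
    (assoc (polyPiece r) (k + 1) : AbSheaf r) ⟶ fieldSheaf r k :=
  assocMap (LinearMap.single (P r) (fun _ => P r) i) (k + 1) k fun j m hm l => by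
    rw [LinearMap.single_apply]
    rcases eq_or_ne l i with rfl | h
    · rw [Pi.single_eq_same, add_right_comm]; exact hm
    · rw [Pi.single_eq_of_ne h]; exact AddSubgroup.zero_mem _

lemma sum_fieldCoeff_comp_fieldSingle (k : ℤ) :
    ∑ i, fieldCoeff (r := r) k i ≫ fieldSingle k i = 𝟙 _ := by
  refine (Finset.sum_congr rfl fun i _ => assocMap_comp _ _).trans ?_
  refine (assocMap_sum _ _).trans (Eq.trans (assocMap_ext _ _ ?_) assocMap_id)
  refine LinearMap.ext fun m => ?_
  rw [LinearMap.sum_apply]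
  exact LinearMap.sum_single_apply _ m

lemma subsingleton_H_one_fieldSheaf (hr : 2 ≤ r) (k : ℤ) :
    Subsingleton (Sheaf.H (fieldSheaf r k) 1) :=
  have := subsingleton_H_one_structureSheaf hr (k + 1)
  subsingleton_H_of_sum_comp_eq_id _ _ (sum_fieldCoeff_comp_fieldSingle k) 1

/-! ### The sheaf associated with the gradient ideal -/

/-- The homogeneous pieces of the gradient ideal. -/
abbrev gradientPiece (f : P r) : ℤ → AddSubgroup (gradientIdeal f) :=
  subPiece (polyPiece r) (gradientIdeal f : Submodule (P r) (P r))

/-- The twists `J(f)^~(k)` of the ideal sheaf on `ℙ^r` associated with the gradient ideal. -/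
abbrev gradientSheaf (f : P r) (k : ℤ) : AbSheaf r := assoc (gradientPiece f) k

/-- The pairing `gradPairing f` as a map to the gradient ideal. -/
def gradLin (f : P r) : (Fin (r + 1) → P r) →ₗ[P r] gradientIdeal f :=
  (gradPairing f).codRestrict (gradientIdeal f : Submodule (P r) (P r)) (gradPairing_mem f)

/-- The projection of the gradient ideal onto its image in the coordinate ring. -/
def gradientProj (f : P r) : gradientIdeal f →ₗ[P r] jacobianModule f :=
  (Submodule.mkQ (Ideal.span {f} : Submodule (P r) (P r))).submoduleMap (gradientIdeal f)

variable {d : ℕ} {f : P r}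

/-- The morphism `𝒪(1)^{r+1}(k - d) ⟶ J(f)^~(k)`, `∑ Aᵢ ∂/∂Xᵢ ↦ ∑ Aᵢ ∂f/∂Xᵢ`. -/
def gradPairingSheaf (hf : f.IsHomogeneous d) (k : ℤ) :
    fieldSheaf r (k - d) ⟶ gradientSheaf f k :=
  assocMap (gradLin f) (k - d) k fun i A hA => by
    have := gradPairing_deg hf _ hA
    rwa [show k - d + i + d = k + i by ring] at this

/-- The projection `J(f)^~(k) ⟶ 𝒥_{f/X}(k)`. -/
def gradientToJacobian (f : P r) (k : ℤ) : gradientSheaf f k ⟶ jacobianSheafX f k :=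
  assocMap (gradientProj f) k k fun _ m hm => ⟨m.1, hm, rfl⟩

/-- The projection `𝒪(1)^{r+1}(k) ⟶ T_{ℙ^r}(k)` of the Euler sequence. -/
def fieldToTangent (k : ℤ) : fieldSheaf r k ⟶ tangentSheaf r k :=
  assocMap (Submodule.mkQ (eulerSpan r)) k k fun _ m hm => ⟨m, hm, rfl⟩

lemma gradPairingSheaf_comp_gradientToJacobian (hf : f.IsHomogeneous d) (k : ℤ) :
    gradPairingSheaf hf k ≫ gradientToJacobian f k = fieldToTangent (k - d) ≫ eta hf k := by
  ext U t
  have hcomp : gradientProj f ∘ₗ gradLin f = etaLin hf ∘ₗ (eulerSpan r).mkQ := rfl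
  refine Subtype.ext (funext fun x => (localizedMap_comp _ (gradLin f) _).trans ?_)
  rw [hcomp]
  exact (localizedMap_comp (etaLin hf) _ _).symm

lemma exists_gradPairing_eq (hd : 1 ≤ d) (hf : f.IsHomogeneous d) {n l : ℤ}
    (hnl : l + d = n) {a : P r} (ha : a ∈ polyPiece r n) (haJ : a ∈ gradientIdeal f) :
    ∃ B ∈ fieldPiece r l, gradPairing f B = a := by
  obtain ⟨c, rfl⟩ := Ideal.mem_span_range_iff_exists_fun.1 haJ
  refine ⟨fun i => polyProj r (l + 1) (c i), fun i => polyProj_mem _ _, ?_⟩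
  rw [gradPairing_apply, ← polyProj_of_mem ha, map_sum]
  refine Finset.sum_congr rfl fun i _ => ?_
  have hdeg : l + 1 + (d - 1 : ℕ) = n := by omega
  rw [mul_comm, mul_comm (c i), ← hdeg, polyProj_mul hf.pderiv]

lemma epi_gradPairingSheaf (hd : 1 ≤ d) (hf : f.IsHomogeneous d) (k : ℤ) :
    Epi (gradPairingSheaf hf k) := by
  refine epi_assocMap _ fun i n hn => ?_
  obtain ⟨B, hB, hBn⟩ := exists_gradPairing_eq hd hf (l := k - d + i) (by ring) hn n.2
  exact ⟨B, hB, Subtype.ext hBn⟩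

/-- The sheaf of the vector fields on affine space that annihilate `f`. -/
def gradKernel (hf : f.IsHomogeneous d) (k : ℤ) : AbSheaf r :=
  Limits.kernel (gradPairingSheaf hf k)

/-- The inclusion of `gradKernel` into `𝒪(1)^{r+1}(k - d)`. -/
def gradKernelIncl (hf : f.IsHomogeneous d) (k : ℤ) : gradKernel hf k ⟶ fieldSheaf r (k - d) :=
  Limits.kernel.ι (gradPairingSheaf hf k)

instance (hf : f.IsHomogeneous d) (k : ℤ) : Mono (gradKernelIncl hf k) :=
  inferInstanceAs (Mono (Limits.kernel.ι (gradPairingSheaf hf k)))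

lemma gradKernelIncl_comp (hf : f.IsHomogeneous d) (k : ℤ) :
    gradKernelIncl hf k ≫ gradPairingSheaf hf k = 0 :=
  Limits.kernel.condition _

/-- The sequence `0 → gradKernel → 𝒪(1)^{r+1}(k - d) → J(f)^~(k) → 0`. -/
def gradSeq (hf : f.IsHomogeneous d) (k : ℤ) : ShortComplex (AbSheaf r) :=
  .mk (gradKernelIncl hf k) (gradPairingSheaf hf k) (gradKernelIncl_comp hf k)

lemma gradSeq_shortExact (hd : 1 ≤ d) (hf : f.IsHomogeneous d) (k : ℤ) :
    (gradSeq hf k).ShortExact where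
  exact := ShortComplex.exact_kernel _
  mono_f := inferInstanceAs (Mono (gradKernelIncl hf k))
  epi_g := epi_gradPairingSheaf hd hf k

/-- The projection `gradKernel ⟶ T⟨X⟩(k - d)`. -/
def gradKernelToLog (hf : f.IsHomogeneous d) (k : ℤ) : gradKernel hf k ⟶ logSheaf hf k :=
  Limits.kernel.map (gradPairingSheaf hf k) (eta hf k) (fieldToTangent (k - d))
    (gradientToJacobian f k) (gradPairingSheaf_comp_gradientToJacobian hf k)

lemma gradKernelToLog_comp_logIncl (hf : f.IsHomogeneous d) (k : ℤ) :
    gradKernelToLog hf k ≫ logIncl hf k = gradKernelIncl hf k ≫ fieldToTangent (k - d) :=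
  Limits.kernel.lift_ι _ _ _

/-- The projection of the sequence of the gradient ideal onto the sequence of `T⟨X⟩`. -/
def gradSeqToLogSeq (hf : f.IsHomogeneous d) (k : ℤ) : gradSeq hf k ⟶ logSeq hf k where
  τ₁ := gradKernelToLog hf k
  τ₂ := fieldToTangent (k - d)
  τ₃ := gradientToJacobian f k
  comm₁₂ := gradKernelToLog_comp_logIncl hf k
  comm₂₃ := (gradPairingSheaf_comp_gradientToJacobian hf k).symm

/-! ### Logarithmic fields as affine fields annihilating `f` -/

lemma gradPairing_euler (hf : f.IsHomogeneous d) (b : P r) :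
    gradPairing f (b • fun i => X i) = b * (d * f) := by
  rw [map_smul, gradPairing_apply, hf.sum_X_mul_pderiv, nsmul_eq_mul, smul_eq_mul]

lemma eq_zero_of_mem_eulerSpan (hd : 1 ≤ d) (hf : f.IsHomogeneous d) (hf0 : f ≠ 0)
    {A : Fin (r + 1) → P r} (hA : A ∈ eulerSpan r) (h : gradPairing f A = 0) : A = 0 := by
  obtain ⟨b, rfl⟩ := Submodule.mem_span_singleton.1 hA
  have hd0 : (d : P r) ≠ 0 := Nat.cast_ne_zero.2 (by omega)
  rw [gradPairing_euler hf] at h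
  rw [(mul_eq_zero.1 h).resolve_right (mul_ne_zero hd0 hf0), zero_smul]

lemma localizedField_eq_zero (hd : 1 ≤ d) (hf : f.IsHomogeneous d) (hf0 : f ≠ 0)
    {x : ProjectiveSpectrum (gradP r)} {z : LocalizedModule (compl x) (Fin (r + 1) → P r)}
    (hgrad : LocalizedModule.map (compl x) (gradLin f) z = 0)
    (htan : LocalizedModule.map (compl x) (Submodule.mkQ (eulerSpan r)) z = 0) : z = 0 := by
  induction z using LocalizedModule.induction_on with
  | h A s =>
    rw [LocalizedModule.map_mk, localizedMk_eq_zero_iff] at hgrad htan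
    obtain ⟨u, hu, huA⟩ := hgrad
    obtain ⟨v, hv, hvA⟩ := htan
    have hA : gradPairing f A = 0 :=
      (mul_eq_zero.1 (congrArg Subtype.val huA)).resolve_left (ne_zero_of_mem_compl hu)
    rw [← map_smul] at hvA
    refine localizedMk_eq_zero_iff.2 ⟨v, hv, eq_zero_of_mem_eulerSpan hd hf hf0
      ((Submodule.Quotient.mk_eq_zero _).1 hvA) ?_⟩
    rw [map_smul, hA, smul_zero]

lemma mono_gradKernelToLog (hd : 1 ≤ d) (hf : f.IsHomogeneous d) (hf0 : f ≠ 0) (k : ℤ) :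
    Mono (gradKernelToLog hf k) := by
  refine Preadditive.mono_of_cancel_zero _ fun {Z} t ht => ?_
  have htan : (t ≫ gradKernelIncl hf k) ≫ fieldToTangent (k - d) = 0 := by
    rw [Category.assoc, ← gradKernelToLog_comp_logIncl, ← Category.assoc, ht, Limits.zero_comp]
  have hgrad : (t ≫ gradKernelIncl hf k) ≫ gradPairingSheaf hf k = 0 := by
    rw [Category.assoc, gradKernelIncl_comp, Limits.comp_zero]
  rw [← cancel_mono (gradKernelIncl hf k), Limits.zero_comp]
  generalize t ≫ gradKernelIncl hf k = u at htan hgrad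
  ext U z
  exact Subtype.ext (funext fun x => localizedField_eq_zero hd hf hf0
    (congrFun (congrArg Subtype.val (congrArg (fun v => v.hom.app U z) hgrad)) x)
    (congrFun (congrArg Subtype.val (congrArg (fun v => v.hom.app U z) htan)) x))

lemma polyProj_mul_of_mem {q : ℤ} {p : P r} (hp : p ∈ polyPiece r q) (n : ℕ) (u : P r) :
    polyProj r (q + n) (u * p) = homogeneousComponent n u * p := by
  rcases hp with rfl | ⟨m, rfl, h⟩
  · simp
  · rw [mul_comm, add_comm (m : ℤ) (n : ℤ), polyProj_mul h, polyProj_natCast, mul_comm]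

lemma exists_homogeneous_mul_eq {q : ℤ} {p u v : P r} (hf : f.IsHomogeneous d)
    (hp : p ∈ polyPiece r (q + d)) {x : ProjectiveSpectrum (gradP r)} (hu : u ∈ compl x)
    (huv : u * p = f * v) :
    ∃ n, ∃ w ∈ gradP r n, w ∈ compl x ∧ ∃ v' ∈ polyPiece r (q + n), w * p = f * v' := by
  obtain ⟨n, hn⟩ := exists_proj_notMem hu
  rw [GradedRing.proj_apply, coe_decompose_gradP] at hn
  refine ⟨n, _, homogeneousComponent_isHomogeneous n u, hn, polyProj r (q + n) v,
    polyProj_mem _ _, ?_⟩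
  rw [← polyProj_mul_of_mem hp, huv, ← polyProj_mul hf, add_right_comm]

lemma exists_mkQ_eq_of_gradPairing_eq_mul (hd : 1 ≤ d) (hf : f.IsHomogeneous d) {j : ℤ}
    {A : Fin (r + 1) → P r} (hA : A ∈ fieldPiece r j) {v : P r} (hv : v ∈ polyPiece r j)
    (hAv : gradPairing f A = f * v) :
    ∃ B ∈ fieldPiece r j, gradPairing f B = 0 ∧ (eulerSpan r).mkQ B = (eulerSpan r).mkQ A := by
  have hC : (C (d : ℂ)⁻¹ : P r) * d = 1 := by
    rw [← map_natCast (C : ℂ →+* P r) d, ← C_mul,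
      inv_mul_cancel₀ (Nat.cast_ne_zero.2 (by omega)), C_1]
  have hCX (l : Fin (r + 1)) : C (d : ℂ)⁻¹ * X l ∈ gradP r 1 := by
    simpa using (isHomogeneous_C (Fin (r + 1)) (d : ℂ)⁻¹).mul (isHomogeneous_X ℂ l)
  refine ⟨A - (C (d : ℂ)⁻¹ * v) • fun l => X l, fun l => ?_, ?_, ?_⟩
  · refine AddSubgroup.sub_mem _ (hA l) ?_
    rw [Pi.smul_apply, smul_eq_mul, mul_right_comm]
    exact mul_mem_polyPiece (hCX l) hv (by norm_num)
  · rw [map_sub, gradPairing_euler hf, hAv]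
    linear_combination (-v * f) * hC
  · rw [map_sub, sub_eq_self]
    exact (Submodule.Quotient.mk_eq_zero _).2
      (Submodule.smul_mem _ _ (Submodule.mem_span_singleton_self _))

lemma exists_local_lift (hd : 1 ≤ d) (hf : f.IsHomogeneous d) (k : ℤ) {U : Opens (ProjSpace r)}
    (t : (tangentSheaf r (k - d)).obj.obj (op U)) (ht : (eta hf k).hom.app (op U) t = 0)
    {x : ProjSpace r} (hx : x ∈ U) :
    ∃ (V : Opens (ProjSpace r)) (hVU : V ≤ U) (A : (fieldSheaf r (k - d)).obj.obj (op V)), x ∈ V ∧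
      (gradPairingSheaf hf k).hom.app (op V) A = 0 ∧
      (fieldToTangent (k - d)).hom.app (op V) A = TopCat.Presheaf.restrictOpen t V hVU := by
  obtain ⟨V, hxV, ι, i, _, s, ⟨A, hA, rfl⟩, hs, hsV, htV⟩ := t.2 ⟨x, hx⟩
  have hη : LocalizedModule.map (compl x) (etaLin hf) (t.1 ⟨x, hx⟩) = 0 :=
    congrFun (congrArg Subtype.val ht) ⟨x, hx⟩
  have hAx : t.1 ⟨x, hx⟩ =
      LocalizedModule.mk (Submodule.Quotient.mk A) ⟨s, hsV ⟨x, hxV⟩⟩ := htV ⟨x, hxV⟩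
  rw [hAx, LocalizedModule.map_mk, localizedMk_eq_zero_iff] at hη
  obtain ⟨u, hu, huA⟩ := hη
  obtain ⟨v, hv⟩ : f ∣ u * gradPairing f A := Ideal.mem_span_singleton.1
    ((Submodule.Quotient.mk_eq_zero _).1 (congrArg Subtype.val huA))
  obtain ⟨n, w, hw, hwx, v', hv', hwv'⟩ := exists_homogeneous_mul_eq hf
    (gradPairing_deg hf _ hA) hu hv
  obtain ⟨B, hB, hB0, hBA⟩ := exists_mkQ_eq_of_gradPairing_eq_mul hd hf
    (GradedPieces.smul_mem hw hA) hv' ((map_smul _ w A).trans hwv')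
  let W : Opens (ProjSpace r) := V ⊓ ProjectiveSpectrum.basicOpen (gradP r) w
  have hswW (y : W) : s * w ∈ compl y.1 := Submonoid.mul_mem _ (hsV ⟨y.1, y.2.1⟩) y.2.2
  have hBW : B ∈ fieldPiece r (k - d + (i + n : ℕ)) := by rwa [Nat.cast_add, ← add_assoc]
  refine ⟨W, inf_le_left.trans ι.le, fracSection (SetLike.mul_mem_graded hs hw) hBW hswW,
    ⟨hxV, hwx⟩, Subtype.ext (funext fun y => ?_), Subtype.ext (funext fun y => ?_)⟩
  · refine (LocalizedModule.map_mk _ (gradLin f) B _).trans ?_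
    rw [show gradLin f B = 0 from Subtype.ext hB0, LocalizedModule.zero_mk]
    rfl
  · refine (LocalizedModule.map_mk _ (eulerSpan r).mkQ B _).trans ?_
    refine Eq.trans ?_ (htV ⟨y.1, y.2.1⟩).symm
    rw [hBA, map_smul]
    have hwy : w ∈ compl y.1 := y.2.2
    exact LocalizedModule.mk_cancel_common_right (⟨s, hsV ⟨y.1, y.2.1⟩⟩ : compl y.1) ⟨w, hwy⟩
      ((eulerSpan r).mkQ A)

lemma epi_gradKernelToLog (hd : 1 ≤ d) (hf : f.IsHomogeneous d) (k : ℤ) :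
    Epi (gradKernelToLog hf k) := by
  refine (TopCat.Sheaf.isLocallySurjective_iff_epi _).1 ?_
  refine (TopCat.Presheaf.isLocallySurjective_iff _).2 fun U t x hx => ?_
  obtain ⟨V, hVU, A, hxV, hA0, hAt⟩ := exists_local_lift hd hf k
    ((logIncl hf k).hom.app (op U) t) (app_g_app_f (S := logSeq hf k) U t) hx
  obtain ⟨A', rfl⟩ := TopCat.Sheaf.sections_exact_of_left_exact
    (gradSeq_shortExact hd hf k).exact (gradSeq_shortExact hd hf k).mono_f A hA0
  refine ⟨V, hVU, ⟨A', app_injective_of_mono (logIncl hf k) V ?_⟩, hxV⟩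
  refine Eq.trans ?_ (hAt.trans (TopCat.Presheaf.map_restrict (logIncl hf k).hom hVU t).symm)
  exact congrArg (fun v => v.hom.app (op V) A') (gradKernelToLog_comp_logIncl hf k)

lemma isIso_gradKernelToLog (hd : 1 ≤ d) (hf : f.IsHomogeneous d) (hf0 : f ≠ 0) (k : ℤ) :
    IsIso (gradKernelToLog hf k) :=
  have := mono_gradKernelToLog hd hf hf0 k
  have := epi_gradKernelToLog hd hf k
  isIso_of_mono_of_epi _

/-! ### Global sections of `J(f)^~(k)` and the saturation of `J(f)` -/

/-- The group `H⁰(J(f)^~(k))`. -/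
abbrev H0Gradient (f : P r) (k : ℤ) : Type := (gradientSheaf f k).obj.obj (op ⊤)

/-- The section `s` of `J(f)^~(k)` is the polynomial `a`, regarded as a section of `𝒪(k)`. -/
def IsGivenBy {k : ℤ} (s : H0Gradient f k) (a : P r) : Prop :=
  ∀ x : (⊤ : Opens (ProjSpace r)), LocalizedModule.map (compl x.1)
    (Submodule.subtype (gradientIdeal f : Submodule (P r) (P r))) (s.1 x) = LocalizedModule.mk a 1

/-- The polynomial `a` lies in the saturation of the gradient ideal of `f` with respect to the
irrelevant ideal. -/
def IsSaturated (f a : P r) : Prop := ∃ N : ℕ, ∀ i : Fin (r + 1), X i ^ N * a ∈ gradientIdeal f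

lemma map_subtype_injective (x : ProjectiveSpectrum (gradP r)) :
    Function.Injective (LocalizedModule.map (compl x)
      (Submodule.subtype (gradientIdeal f : Submodule (P r) (P r)))) :=
  LocalizedModule.map_injective _ _ (Submodule.subtype_injective _)

lemma map_subtype_mk_eq_iff {x : ProjectiveSpectrum (gradP r)} {m : gradientIdeal f}
    {s : compl x} {a : P r} :
    LocalizedModule.map (compl x) (Submodule.subtype (gradientIdeal f : Submodule (P r) (P r)))
      (LocalizedModule.mk m s) = LocalizedModule.mk a 1 ↔ m.1 = s * a := by
  rw [LocalizedModule.map_mk, mk_eq_mk_iff_mul_eq (compl_le_nonZeroDivisors x),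
    OneMemClass.coe_one, one_mul]
  rfl

lemma eq_mk_one_of_forall_map_proj_eq {R ι : Type*} [CommRing R] {S : Submonoid R}
    (hS : S ≤ nonZeroDivisors R) {z : LocalizedModule S (ι → R)} {b : ι → R}
    (h : ∀ i, LocalizedModule.map S (LinearMap.proj i : (ι → R) →ₗ[R] R) z =
      LocalizedModule.mk (b i) 1) : z = LocalizedModule.mk b 1 := by
  induction z using LocalizedModule.induction_on with
  | h m t =>
    refine LocalizedModule.mk_eq.2 ⟨1, congrArg _ (funext fun i => ?_)⟩
    have := h i
    rwa [LocalizedModule.map_mk, mk_eq_mk_iff_mul_eq hS] at this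

section GlobalSections

variable {k : ℤ} {s s' : H0Gradient f k} {a a' : P r}

lemma IsGivenBy.section_unique (h : IsGivenBy s a) (h' : IsGivenBy s' a) : s = s' :=
  Subtype.ext (funext fun x => map_subtype_injective x.1 ((h x).trans (h' x).symm))

lemma IsGivenBy.polynomial_unique (h : IsGivenBy s a) (h' : IsGivenBy s a') : a = a' := by
  have := (h ⟨genericPt r, trivial⟩).symm.trans (h' ⟨genericPt r, trivial⟩)
  rw [mk_eq_mk_iff_mul_eq (compl_le_nonZeroDivisors _)] at this
  simpa using this

lemma IsGivenBy.sub (h : IsGivenBy s a) (h' : IsGivenBy s' a') :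
    IsGivenBy (s - s') (a - a') := by
  intro x
  refine (map_sub _ (s.1 x) (s'.1 x)).trans ?_
  rw [h x, h' x]
  exact (map_sub (LocalizedModule.mkLinearMap (compl x.1) (P r)) a a').symm

lemma IsGivenBy.mul {j : ℕ} (g : gradP r j) {l : ℤ} (hkl : k + j = l) (h : IsGivenBy s a) :
    IsGivenBy ((assocMul (gradientPiece f) g k l hkl).hom.app (op ⊤) s) (g.1 * a) := by
  intro x
  refine (localizedMap_comp (Submodule.subtype _) (LinearMap.lsmul (P r) _ g.1) (s.1 x)).trans ?_
  refine (localizedMap_comp (LinearMap.lsmul (P r) (P r) g.1) (Submodule.subtype _)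
    (s.1 x)).symm.trans ?_
  rw [h x, LocalizedModule.map_mk]
  rfl

lemma exists_isGivenBy (hr : 1 ≤ r) (s : H0Gradient f k) : ∃ a ∈ polyPiece r k, IsGivenBy s a :=
  exists_forall_section_eq_mk hr ((assocMap (𝓜 := gradientPiece f) (𝓝 := polyPiece r)
    (Submodule.subtype (gradientIdeal f : Submodule (P r) (P r))) k k
    (fun _ _ hm => hm)).hom.app (op ⊤) s)

lemma IsGivenBy.mem_polyPiece (hr : 1 ≤ r) (h : IsGivenBy s a) : a ∈ polyPiece r k := by
  obtain ⟨a', ha', h'⟩ := exists_isGivenBy hr s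
  rwa [h.polynomial_unique h']

lemma IsGivenBy.exists_mul_mem (h : IsGivenBy s a) (x : ProjectiveSpectrum (gradP r)) :
    ∃ t : P r, t * a ∈ gradientIdeal f ∧ SetLike.IsHomogeneousElem (gradP r) t ∧ t ∈ compl x := by
  obtain ⟨V, hV, _, i, m, t, _, ht, hx, hst⟩ := s.2 ⟨x, trivial⟩
  have hsx := h ⟨x, trivial⟩
  rw [show s.1 ⟨x, trivial⟩ = _ from hst ⟨x, hV⟩] at hsx
  refine ⟨t, ?_, ⟨i, ht⟩, hx ⟨x, hV⟩⟩
  rw [← map_subtype_mk_eq_iff.1 hsx]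
  exact m.2

lemma IsGivenBy.isSaturated (h : IsGivenBy s a) : IsSaturated f a := by
  obtain ⟨N, hN⟩ := exists_forall_X_pow_mem
    (I := Submodule.colon (gradientIdeal f : Submodule (P r) (P r)) {a}) fun x => by
      obtain ⟨t, hta, ht⟩ := h.exists_mul_mem x
      exact ⟨t, Submodule.mem_colon_singleton.2 hta, ht⟩
  exact ⟨N, fun i => Submodule.mem_colon_singleton.1 (hN i)⟩

lemma IsSaturated.exists_isGivenBy (hsat : IsSaturated f a) (ha : a ∈ polyPiece r k) :
    ∃ s : H0Gradient f k, IsGivenBy s a := by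
  obtain ⟨N, hN⟩ := hsat
  choose i hi using exists_X_mem_compl (r := r)
  have hiN (x) : (X (i x) : P r) ^ N ∈ compl x := Submonoid.pow_mem _ (hi x) N
  have hval (x) (j : Fin (r + 1)) (hj : (X j : P r) ^ N ∈ compl x) :=
    map_subtype_mk_eq_iff (f := f) (m := ⟨X j ^ N * a, hN j⟩) (s := ⟨X j ^ N, hj⟩).2 rfl
  refine ⟨⟨fun x => LocalizedModule.mk ⟨X (i x.1) ^ N * a, hN _⟩ ⟨X (i x.1) ^ N, hiN x.1⟩,
    fun x => ?_⟩, fun x => hval x.1 _ _⟩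
  have hX : (X (i x.1) : P r) ^ N ∈ gradP r (N * 1) := pow_mem_gradP (isHomogeneous_X ℂ _) N
  let V : Opens (ProjSpace r) := ProjectiveSpectrum.basicOpen (gradP r) (X (i x.1))
  exact ⟨V, hi x.1, homOfLE le_top, N * 1, ⟨X (i x.1) ^ N * a, hN _⟩, X (i x.1) ^ N,
    mul_mem_polyPiece hX ha rfl, hX, fun y => Submonoid.pow_mem _ y.2 N, fun y =>
      map_subtype_injective y.1 ((hval y.1 _ _).trans (hval y.1 _ _).symm)⟩

lemma IsGivenBy.jacobianIncl_eq (ha : a ∈ polyPiece r k) (h : IsGivenBy s a) :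
    H0JacobianIncl f k ((gradientToJacobian f k).hom.app (op ⊤) s) = polySection f k a ha := by
  refine Subtype.ext (funext fun x => ?_)
  refine (localizedMap_comp (jacobianModule f).subtype (gradientProj f) (s.1 x)).trans ?_
  have hx := congrArg (LocalizedModule.map (compl x.1)
    (Submodule.mkQ (Ideal.span {f} : Submodule (P r) (P r)))) (h x)
  rw [localizedMap_comp, LocalizedModule.map_mk] at hx
  exact hx

lemma isGivenBy_gradPairingSheaf (hf : f.IsHomogeneous d)
    (A : (fieldSheaf r (k - d)).obj.obj (op ⊤)) (B : Fin (r + 1) → P r)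
    (hAB : ∀ x, A.1 x = LocalizedModule.mk B 1) :
    IsGivenBy ((gradPairingSheaf hf k).hom.app (op ⊤) A) (gradPairing f B) := by
  intro x
  refine (localizedMap_comp (Submodule.subtype _) (gradLin f) (A.1 x)).trans ?_
  rw [hAB, LocalizedModule.map_mk]
  rfl

lemma exists_forall_fieldSection_eq_mk (hr : 1 ≤ r) (A : (fieldSheaf r k).obj.obj (op ⊤)) :
    ∃ B : Fin (r + 1) → P r, ∀ x, A.1 x = LocalizedModule.mk B 1 := by
  have hcoeff (i : Fin (r + 1)) : ∃ b : P r, ∀ x : (⊤ : Opens (ProjSpace r)),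
      LocalizedModule.map (compl x.1) (LinearMap.proj i : (Fin (r + 1) → P r) →ₗ[P r] P r)
        (A.1 x) = LocalizedModule.mk b 1 := by
    obtain ⟨b, -, hb⟩ := exists_forall_section_eq_mk hr ((fieldCoeff k i).hom.app (op ⊤) A)
    exact ⟨b, hb⟩
  choose B hB using hcoeff
  exact ⟨B, fun x => eq_mk_one_of_forall_map_proj_eq (compl_le_nonZeroDivisors x.1) fun i => hB i x⟩

lemma IsGivenBy.mem_gradientIdeal_iff (hr : 1 ≤ r) (hd : 1 ≤ d) (hf : f.IsHomogeneous d)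
    (h : IsGivenBy s a) :
    a ∈ gradientIdeal f ↔ ∃ A, (gradPairingSheaf hf k).hom.app (op ⊤) A = s := by
  constructor
  · intro haJ
    obtain ⟨B, hB, rfl⟩ :=
      exists_gradPairing_eq hd hf (sub_add_cancel k d) (h.mem_polyPiece hr) haJ
    exact ⟨assocSection (fieldPiece r) (k - d) B hB,
      (isGivenBy_gradPairingSheaf hf _ B fun _ => rfl).section_unique h⟩
  · rintro ⟨A, rfl⟩
    obtain ⟨B, hAB⟩ := exists_forall_fieldSection_eq_mk hr A
    rw [h.polynomial_unique (isGivenBy_gradPairingSheaf hf A B hAB)]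
    exact gradPairing_mem f B

end GlobalSections

/-! ### The connecting homomorphism -/

lemma map_gradKernelToLog_connectingHom (hd : 1 ≤ d) (hf : f.IsHomogeneous d) {k : ℤ}
    (s : H0Gradient f k) :
    Sheaf.H.map (gradKernelToLog hf k) 1 (connectingHom (gradSeq_shortExact hd hf k) s) =
      connecting hf k ((gradientToJacobian f k).hom.app (op ⊤) s) :=
  map_connectingHom _ (logSeq_shortExact hf k) (gradSeqToLogSeq hf k) s

lemma connecting_gradientToJacobian_eq_zero_iff (hd : 1 ≤ d) (hf : f.IsHomogeneous d)
    (hf0 : f ≠ 0) {k : ℤ} {s : H0Gradient f k} :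
    connecting hf k ((gradientToJacobian f k).hom.app (op ⊤) s) = 0 ↔
      ∃ A, (gradPairingSheaf hf k).hom.app (op ⊤) A = s := by
  have := isIso_gradKernelToLog hd hf hf0 k
  rw [← map_gradKernelToLog_connectingHom hd]
  exact (map_eq_zero_iff _ (bijective_map_of_isIso (gradKernelToLog hf k) 1).1).trans
    (connectingHom_eq_zero_iff (gradSeq_shortExact hd hf k))

lemma exists_connecting_gradientToJacobian_eq (hr : 2 ≤ r) (hd : 1 ≤ d) (hf : f.IsHomogeneous d)
    (hf0 : f ≠ 0) {k : ℤ} (c : H1Log hf k) :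
    ∃ s, connecting hf k ((gradientToJacobian f k).hom.app (op ⊤) s) = c := by
  have := isIso_gradKernelToLog hd hf hf0 k
  have : Subsingleton (Sheaf.H (gradSeq hf k).X₂ 1) := subsingleton_H_one_fieldSheaf hr (k - d)
  obtain ⟨c', rfl⟩ := (bijective_map_of_isIso (gradKernelToLog hf k) 1).2 c
  obtain ⟨s, rfl⟩ := connectingHom_surjective (gradSeq_shortExact hd hf k) c'
  exact ⟨s, (map_gradKernelToLog_connectingHom hd hf s).symm⟩

/-- Multiplication by a homogeneous polynomial as a morphism of exact sequences. -/
def logSeqMul (hf : f.IsHomogeneous d) {j : ℕ} (g : gradP r j) (k l : ℤ) (h : k + j = l) :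
    logSeq hf k ⟶ logSeq hf l where
  τ₁ := logMul hf g k l h
  τ₂ := assocMul (quotPiece (fieldPiece r) (eulerSpan r)) g (k - d) (l - d) (by omega)
  τ₃ := assocMul (jacobianPiece f) g k l h
  comm₁₂ := logMul_ι hf g k l h
  comm₂₃ := (eta_mul hf g k l h).symm

lemma logAct_connecting (hf : f.IsHomogeneous d) {j : ℕ} (g : gradP r j) {k l : ℤ} (h : k + j = l)
    (s : H0Jacobian f k) : logAct hf g k l h (connecting hf k s) =
      connecting hf l ((assocMul (jacobianPiece f) g k l h).hom.app (op ⊤) s) :=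
  map_connectingHom (logSeq_shortExact hf k) (logSeq_shortExact hf l) (logSeqMul hf g k l h) s

lemma gradientToJacobian_comp_assocMul {j : ℕ} (g : gradP r j) {k l : ℤ} (h : k + j = l) :
    gradientToJacobian f k ≫ assocMul (jacobianPiece f) g k l h =
      assocMul (gradientPiece f) g k l h ≫ gradientToJacobian f l := by
  ext U s
  refine Subtype.ext (funext fun x => ?_)
  refine (localizedMap_comp (LinearMap.lsmul (P r) _ g.1) (gradientProj f) (s.1 x)).trans ?_
  exact (localizedMap_comp (gradientProj f) (LinearMap.lsmul (P r) _ g.1) (s.1 x)).symm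

/-- The class `c ∈ H¹(T⟨X⟩(k - d))` is the image under the connecting homomorphism of the section of
`𝒥_{f/X}(k)` given by the polynomial `a`. -/
def IsConnectingClass (hf : f.IsHomogeneous d) {k : ℤ} (a : P r) (c : H1Log hf k) : Prop :=
  ∃ s : H0Gradient f k, IsGivenBy s a ∧
    connecting hf k ((gradientToJacobian f k).hom.app (op ⊤) s) = c

section IsConnectingClass

variable {hf : f.IsHomogeneous d} {k : ℤ} {a a' : P r} {c c' : H1Log hf k}

lemma exists_isConnectingClass (hr : 2 ≤ r) (hd : 1 ≤ d) (hf0 : f ≠ 0) (c : H1Log hf k) :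
    ∃ a, IsConnectingClass hf a c := by
  obtain ⟨s, rfl⟩ := exists_connecting_gradientToJacobian_eq hr hd hf hf0 c
  obtain ⟨a, -, hs⟩ := exists_isGivenBy (one_le_two.trans hr) s
  exact ⟨a, s, hs, rfl⟩

lemma IsConnectingClass.mem_polyPiece (hr : 1 ≤ r) (h : IsConnectingClass hf a c) :
    a ∈ polyPiece r k := by
  obtain ⟨s, hs, -⟩ := h
  exact hs.mem_polyPiece hr

lemma IsConnectingClass.isSaturated (h : IsConnectingClass hf a c) : IsSaturated f a := by
  obtain ⟨s, hs, -⟩ := h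
  exact hs.isSaturated

lemma IsConnectingClass.eq_zero_iff (hr : 1 ≤ r) (hd : 1 ≤ d) (hf0 : f ≠ 0)
    (h : IsConnectingClass hf a c) : c = 0 ↔ a ∈ gradientIdeal f := by
  obtain ⟨s, hs, rfl⟩ := h
  rw [connecting_gradientToJacobian_eq_zero_iff hd hf hf0, hs.mem_gradientIdeal_iff hr hd hf]

lemma IsConnectingClass.sub (h : IsConnectingClass hf a c) (h' : IsConnectingClass hf a' c') :
    IsConnectingClass hf (a - a') (c - c') := by
  obtain ⟨s, hs, rfl⟩ := h
  obtain ⟨s', hs', rfl⟩ := h'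
  refine ⟨s - s', hs.sub hs', ?_⟩
  exact map_sub ((connectingHom (logSeq_shortExact hf k)).comp
    ((gradientToJacobian f k).hom.app (op ⊤)).hom) s s'

lemma IsConnectingClass.logAct (hc : IsConnectingClass hf a c) {j : ℕ} (g : gradP r j) {l : ℤ}
    (h : k + j = l) : IsConnectingClass hf (g.1 * a) (logAct hf g k l h c) := by
  obtain ⟨s, hs, rfl⟩ := hc
  refine ⟨(assocMul (gradientPiece f) g k l h).hom.app (op ⊤) s, hs.mul g h, ?_⟩
  rw [logAct_connecting]
  congr 1
  exact (ConcreteCategory.congr_hom (congrArg (fun φ => φ.hom.app (op ⊤))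
    (gradientToJacobian_comp_assocMul g h)) s).symm

lemma IsSaturated.exists_section (hf : f.IsHomogeneous d) (hsat : IsSaturated f a)
    (ha : a ∈ polyPiece r k) : ∃ s : H0Jacobian f k,
      H0JacobianIncl f k s = polySection f k a ha ∧ IsConnectingClass hf a (connecting hf k s) := by
  obtain ⟨s, hs⟩ := hsat.exists_isGivenBy ha
  exact ⟨(gradientToJacobian f k).hom.app (op ⊤) s, hs.jacobianIncl_eq ha, s, hs, rfl⟩

end IsConnectingClass

/-! ### Saturation and local cohomology -/

lemma polyProj_mem_gradientIdeal (hf : f.IsHomogeneous d) {a : P r} (ha : a ∈ gradientIdeal f)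
    (n : ℤ) : polyProj r n a ∈ gradientIdeal f := by
  obtain ⟨c, rfl⟩ := Ideal.mem_span_range_iff_exists_fun.1 ha
  rw [map_sum]
  refine Ideal.sum_mem _ fun i _ => ?_
  rw [mul_comm, ← sub_add_cancel n (d - 1 : ℕ), polyProj_mul hf.pderiv]
  exact Ideal.mul_mem_right _ _ (Ideal.subset_span ⟨i, rfl⟩)

lemma mk_mem_localCohomZero_iff {a : P r} :
    Ideal.Quotient.mk (gradientIdeal f) a ∈ localCohomZero f ↔ IsSaturated f a := by
  have hsmul (b : P r) : b • Ideal.Quotient.mk (gradientIdeal f) a = 0 ↔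
      b * a ∈ gradientIdeal f := Ideal.Quotient.eq_zero_iff_mem (a := b * a)
  constructor
  · rintro ⟨n, hn⟩
    exact ⟨n, fun i =>
      (hsmul _).1 (hn _ (Ideal.pow_mem_pow (Ideal.subset_span (Set.mem_range_self i)) n))⟩
  · rintro ⟨N, hN⟩
    let I : Ideal (P r) := Submodule.colon (gradientIdeal f : Submodule (P r) (P r)) {a}
    have hle : Ideal.span (Set.range (X : Fin (r + 1) → P r)) ≤ I.radical := by
      refine Ideal.span_le.2 ?_
      rintro _ ⟨i, rfl⟩
      exact ⟨N, Submodule.mem_colon_singleton.2 (hN i)⟩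
    obtain ⟨n, hn⟩ := Ideal.exists_pow_le_of_le_radical_of_fg hle
      (Submodule.fg_span (Set.finite_range _))
    exact ⟨n, fun b hb => (hsmul b).2 (Submodule.mem_colon_singleton.1 (hn hb))⟩

lemma IsSaturated.homogeneousComponent (hf : f.IsHomogeneous d) {a : P r} (ha : IsSaturated f a)
    (n : ℕ) : IsSaturated f (homogeneousComponent n a) := by
  obtain ⟨N, hN⟩ := ha
  refine ⟨N, fun i => ?_⟩
  rw [← polyProj_natCast, ← polyProj_mul (pow_mem_gradP (isHomogeneous_X ℂ i) N)]
  exact polyProj_mem_gradientIdeal hf (hN i) _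

lemma IsNonsingular.X_mem_radical (h : IsNonsingular f) (hd : 1 ≤ d) (hf : f.IsHomogeneous d)
    (i : Fin (r + 1)) : (X i : P r) ∈ (gradientIdeal f).radical := by
  rw [← vanishingIdeal_zeroLocus_eq_radical (K := ℂ), mem_vanishingIdeal_iff]
  intro x hx
  have hpderiv (j) : eval x (pderiv j f) = 0 := by
    simpa using hx (pderiv j f) (Ideal.subset_span ⟨j, rfl⟩)
  have hfx : eval x f = 0 := by
    have heuler := congrArg (eval x) hf.sum_X_mul_pderiv
    simp only [map_sum, map_mul, hpderiv, mul_zero, Finset.sum_const_zero, nsmul_eq_mul,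
      map_natCast] at heuler
    exact (mul_eq_zero.1 heuler.symm).resolve_left (Nat.cast_ne_zero.2 (by omega))
  have hx0 : x = 0 := by
    by_contra hne
    obtain ⟨j, hj⟩ := h x hne hfx
    exact hj (hpderiv j)
  simp [hx0]

lemma IsNonsingular.localCohomZero_eq_top (h : IsNonsingular f) (hd : 1 ≤ d)
    (hf : f.IsHomogeneous d) : localCohomZero f = ⊤ := by
  obtain ⟨N, hN⟩ := exists_forall_pow_mem_of_mem_radical (h.X_mem_radical hd hf)
  refine eq_top_iff.2 fun y _ => ?_
  obtain ⟨a, rfl⟩ := Ideal.Quotient.mk_surjective y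
  exact mk_mem_localCohomZero_iff.2 ⟨N, fun i => Ideal.mul_mem_right _ _ (hN i)⟩

/-! ### The isomorphism -/

lemma IsConnectingClass.mk_eq (hr : 1 ≤ r) (hd : 1 ≤ d) {hf : f.IsHomogeneous d} (hf0 : f ≠ 0)
    {k : ℤ} {a a' : P r} {c : H1Log hf k} (h : IsConnectingClass hf a c)
    (h' : IsConnectingClass hf a' c) :
    Ideal.Quotient.mk (gradientIdeal f) a = Ideal.Quotient.mk (gradientIdeal f) a' :=
  Ideal.Quotient.eq.2 (((h.sub h').eq_zero_iff hr hd hf0).1 (sub_self c))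

lemma exists_classHom (hr : 2 ≤ r) (hd : 1 ≤ d) (hf : f.IsHomogeneous d) (hf0 : f ≠ 0) (k : ℤ) :
    ∃ Ψ : H1Log hf k →+ JacobianRing f, ∀ a c, IsConnectingClass hf a c →
      Ψ c = Ideal.Quotient.mk (gradientIdeal f) a := by
  have hr1 : 1 ≤ r := one_le_two.trans hr
  choose a ha using fun c : H1Log hf k => exists_isConnectingClass hr hd hf0 c
  refine ⟨AddMonoidHom.ofMapSub (fun c => Ideal.Quotient.mk (gradientIdeal f) (a c))
    fun c c' => ?_, fun b c h => (ha c).mk_eq hr1 hd hf0 h⟩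
  rw [← map_sub]
  exact (ha (c - c')).mk_eq hr1 hd hf0 ((ha c).sub (ha c'))

lemma exists_eq_sum_of (hf : f.IsHomogeneous d) (y : H1StarLog hf) :
    ∃ (s : Finset ℤ) (c : ∀ k, H1Log hf k), y = ∑ k ∈ s, H1StarLog.of hf k (c k) := by
  let _ : ∀ (k : ℤ) (x : H1Log hf k), Decidable (x ≠ 0) := fun _ _ => Classical.dec _
  exact ⟨DFinsupp.support (β := fun k => H1Log hf k) y, fun k => DFinsupp.toFun y k,
    (DirectSum.sum_support_of (β := fun k => H1Log hf k) y).symm⟩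

/-- The `P`-linear map `Ψ : H¹_*(T⟨X⟩(-d)) → R(f)` inverts the connecting homomorphisms: it sends
the image of the section given by a polynomial `a` to the class of `a`. -/
def IsClassMap {hf : f.IsHomogeneous d} (Ψ : H1StarLog hf →ₗ[P r] JacobianRing f) : Prop :=
  ∀ (k : ℤ) (a : P r) (c : H1Log hf k), IsConnectingClass hf a c →
    Ψ (H1StarLog.of hf k c) = Ideal.Quotient.mk (gradientIdeal f) a

lemma exists_isClassMap (hr : 2 ≤ r) (hd : 1 ≤ d) (hf : f.IsHomogeneous d) (hf0 : f ≠ 0) :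
    ∃ Ψ : H1StarLog hf →ₗ[P r] JacobianRing f, IsClassMap Ψ := by
  choose Ψ hΨ using exists_classHom hr hd hf hf0
  let Φ : H1StarLog hf →+ JacobianRing f :=
    (DirectSum.toAddMonoid Ψ : (⨁ k : ℤ, H1Log hf k) →+ JacobianRing f)
  have hΦ (k : ℤ) (a : P r) (c : H1Log hf k) (h : IsConnectingClass hf a c) :
      Φ (H1StarLog.of hf k c) = Ideal.Quotient.mk (gradientIdeal f) a :=
    (DirectSum.toAddMonoid_of Ψ k c).trans (hΨ k a c h)
  have hsmul_of (p : P r) (k : ℤ) (c : H1Log hf k) :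
      Φ (p • H1StarLog.of hf k c) = p • Φ (H1StarLog.of hf k c) := by
    obtain ⟨a, hac⟩ := exists_isConnectingClass hr hd hf0 c
    induction p using DirectSum.Decomposition.inductionOn (gradP r) with
    | zero => rw [zero_smul, zero_smul, map_zero]
    | @homogeneous j g =>
      rw [H1StarLog.smul_of hf g k (k + j) rfl, hΦ _ _ _ (hac.logAct g rfl), hΦ _ _ _ hac]
      rfl
    | add p q hp hq => rw [add_smul, add_smul, map_add, hp, hq]
  refine ⟨{ Φ with map_smul' := fun p y => ?_ }, hΦ⟩
  change Φ (p • y) = p • Φ y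
  obtain ⟨s, c, rfl⟩ := exists_eq_sum_of hf y
  simp only [Finset.smul_sum, map_sum, hsmul_of]

section IsClassMap

variable {hf : f.IsHomogeneous d} {Ψ : H1StarLog hf →ₗ[P r] JacobianRing f}

lemma IsClassMap.injective (hΨ : IsClassMap Ψ) (hr : 2 ≤ r) (hd : 1 ≤ d) (hf0 : f ≠ 0) :
    Function.Injective Ψ := by
  have hr1 : 1 ≤ r := one_le_two.trans hr
  refine (injective_iff_map_eq_zero Ψ).2 fun y hy => ?_
  obtain ⟨s, c, rfl⟩ := exists_eq_sum_of hf y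
  choose a ha using fun k => exists_isConnectingClass hr hd hf0 (c k)
  have hsum : ∑ k ∈ s, a k ∈ gradientIdeal f := by
    rw [← Ideal.Quotient.eq_zero_iff_mem, map_sum, ← hy, map_sum]
    exact Finset.sum_congr rfl fun k _ => (hΨ k _ _ (ha k)).symm
  refine Finset.sum_eq_zero fun k hk => ?_
  have hak := polyProj_mem_gradientIdeal hf hsum k
  rw [map_sum, Finset.sum_eq_single_of_mem k hk fun l _ hl =>
    polyProj_of_mem_of_ne ((ha l).mem_polyPiece hr1) hl,
    polyProj_of_mem ((ha k).mem_polyPiece hr1)] at hak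
  rw [((ha k).eq_zero_iff hr1 hd hf0).2 hak, map_zero]

lemma IsClassMap.range_eq (hΨ : IsClassMap Ψ) (hr : 2 ≤ r) (hd : 1 ≤ d) (hf0 : f ≠ 0) :
    LinearMap.range Ψ = localCohomZero f := by
  refine le_antisymm ?_ fun y hy => ?_
  · rintro _ ⟨y, rfl⟩
    obtain ⟨s, c, rfl⟩ := exists_eq_sum_of hf y
    rw [map_sum]
    refine Submodule.sum_mem _ fun k _ => ?_
    obtain ⟨a, ha⟩ := exists_isConnectingClass hr hd hf0 (c k)
    rw [hΨ k a _ ha]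
    exact mk_mem_localCohomZero_iff.2 ha.isSaturated
  · obtain ⟨a, rfl⟩ := Ideal.Quotient.mk_surjective y
    have hsat := mk_mem_localCohomZero_iff.1 hy
    rw [← sum_homogeneousComponent a, map_sum]
    refine Submodule.sum_mem _ fun n _ => ?_
    obtain ⟨t, -, ht⟩ := (hsat.homogeneousComponent hf n).exists_section hf (k := n)
      (Or.inr ⟨n, rfl, homogeneousComponent_isHomogeneous n a⟩)
    exact ⟨_, hΨ _ _ _ ht⟩

end IsClassMap

lemma exists_linearEquiv (hr : 2 ≤ r) (hd : 1 ≤ d) (hf : f.IsHomogeneous d) (hf0 : f ≠ 0) :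
    ∃ φ : localCohomZero f ≃ₗ[P r] H1StarLog hf,
      ∀ (k : ℤ) (a : P r) (c : H1Log hf k) (x : localCohomZero f),
        x.1 = Ideal.Quotient.mk (gradientIdeal f) a → IsConnectingClass hf a c →
          φ x = H1StarLog.of hf k c := by
  obtain ⟨Ψ, hΨ⟩ := exists_isClassMap hr hd hf hf0
  let e : H1StarLog hf ≃ₗ[P r] localCohomZero f :=
    (LinearEquiv.ofInjective Ψ (hΨ.injective hr hd hf0)).trans
      (LinearEquiv.ofEq _ _ (hΨ.range_eq hr hd hf0))
  refine ⟨e.symm, fun k a c x hx hc => (LinearEquiv.symm_apply_eq e).2 (Subtype.ext ?_)⟩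
  exact hx.trans (hΨ k a c hc).symm

end LogSheaf

end

theorem proposition2p1_general (r d : ℕ) (hr : 2 ≤ r) (hd : 1 ≤ d) (f : LogSheaf.P r)
    (hf : f.IsHomogeneous d) (hf0 : f ≠ 0) :
    ∃ φ : LogSheaf.localCohomZero f ≃ₗ[LogSheaf.P r] LogSheaf.H1StarLog hf,
      (∀ (k : ℤ) (a : LogSheaf.P r) (ha : a ∈ LogSheaf.polyPiece r k)
          (x : LogSheaf.localCohomZero f), x.1 = Ideal.Quotient.mk (LogSheaf.gradientIdeal f) a →
          ∃ s : LogSheaf.H0Jacobian f k,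
            LogSheaf.H0JacobianIncl f k s = LogSheaf.polySection f k a ha ∧
            φ x = LogSheaf.H1StarLog.of hf k (LogSheaf.connecting hf k s)) ∧
      (∀ (k : ℤ) (c : LogSheaf.H1Log hf k), ∃ a ∈ LogSheaf.polyPiece r k,
          ∃ x : LogSheaf.localCohomZero f, x.1 = Ideal.Quotient.mk (LogSheaf.gradientIdeal f) a ∧
            φ x = LogSheaf.H1StarLog.of hf k c) ∧
      (LogSheaf.IsNonsingular f →
        ∃ ψ : LogSheaf.JacobianRing f ≃ₗ[LogSheaf.P r] LogSheaf.H1StarLog hf,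
          ∀ x : LogSheaf.localCohomZero f, ψ x.1 = φ x) := by
  obtain ⟨φ, hφ⟩ := LogSheaf.exists_linearEquiv hr hd hf hf0
  refine ⟨φ, fun k a ha x hx => ?_, fun k c => ?_, fun hns => ?_⟩
  · have hsat : LogSheaf.IsSaturated f a := LogSheaf.mk_mem_localCohomZero_iff.1 (hx ▸ x.2)
    obtain ⟨s, hs, hc⟩ := hsat.exists_section hf ha
    exact ⟨s, hs, hφ k a _ x hx hc⟩
  · obtain ⟨a, hc⟩ := LogSheaf.exists_isConnectingClass hr hd hf0 c
    exact ⟨a, hc.mem_polyPiece (one_le_two.trans hr),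
      ⟨_, LogSheaf.mk_mem_localCohomZero_iff.2 hc.isSaturated⟩, rfl, hφ k a c _ rfl hc⟩
  · exact ⟨(LinearEquiv.ofTop _ (hns.localCohomZero_eq_top hd hf)).symm.trans φ, fun _ => rfl⟩

theorem proposition2p1 (r d : ℕ) (hr : 2 ≤ r) (hd : 1 ≤ d) (f : LogSheaf.P r)
    (hf : f.IsHomogeneous d) (hred : Squarefree f) :
    ∃ φ : LogSheaf.localCohomZero f ≃ₗ[LogSheaf.P r] LogSheaf.H1StarLog hf,
      (∀ (k : ℤ) (a : LogSheaf.P r) (ha : a ∈ LogSheaf.polyPiece r k)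
          (x : LogSheaf.localCohomZero f), x.1 = Ideal.Quotient.mk (LogSheaf.gradientIdeal f) a →
          ∃ s : LogSheaf.H0Jacobian f k,
            LogSheaf.H0JacobianIncl f k s = LogSheaf.polySection f k a ha ∧
            φ x = LogSheaf.H1StarLog.of hf k (LogSheaf.connecting hf k s)) ∧
      (∀ (k : ℤ) (c : LogSheaf.H1Log hf k), ∃ a ∈ LogSheaf.polyPiece r k,
          ∃ x : LogSheaf.localCohomZero f, x.1 = Ideal.Quotient.mk (LogSheaf.gradientIdeal f) a ∧
            φ x = LogSheaf.H1StarLog.of hf k c) ∧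
      (LogSheaf.IsNonsingular f →
        ∃ ψ : LogSheaf.JacobianRing f ≃ₗ[LogSheaf.P r] LogSheaf.H1StarLog hf,
          ∀ x : LogSheaf.localCohomZero f, ψ x.1 = φ x) := by
  exact proposition2p1_general r d hr hd f hf hred.ne_zero
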